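/- Let $K$ be a field, $S=K[x_1,\ldots,x_n]$ with the standard grading, $\mathfrak m=(x_1,\ldots,x_n)$, and let $I\subseteq S$ be a graded ideal. Let $\mu(\cdot)$ denote the minimal number of generators, let $F(I)=\bigoplus_{k\ge 0} I^k/\mathfrak m I^k$ be the fiber cone of $I$, and let $l=\ell(I)$ be the analytic spread of $I$, that is, the Krull dimension of $F(I)$. Write the Hilbert series of $F(I)$ as $\mathrm{Hilb}_{F(I)}(t)=\sum_{k\ge 0}\dim_K F(I)_k\,t^k=Q(t)/(1-t)^{l}$ with $Q(t)=1+h_1t+h_2t^2+\cdots$, and set $\Delta(I)=\mu(I^2)-l\,\mu(I)+\binom{l}{2}$. Then: (a) If $h_i\ge 0$ for all $i\ge 2$, then $\mu(I^k)\ge\binom{l+k-2}{k-1}\mu(I)-(k-1)\binom{l+k-2}{k}$ for all $k\ge 1$. (b) $\mu(I^k)=\binom{l+k-2}{k-1}\mu(I)-(k-1)\binom{l+k-2}{k}$ for all $k\ge 1$ if and only if $h_i=0$ for all $i\ge 2$. (c) If in addition $F(I)$ is Cohen–Macaulay, then the following conditions are equivalent: (i) $\Delta(I)=0$; (ii) $\mu(I^k)=\binom{l+k-2}{k-1}\mu(I)-(k-1)\binom{l+k-2}{k}$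 for all $k\ge 1$; (iii) $\mu(I^k)=\binom{l+k-2}{k-1}\mu(I)-(k-1)\binom{l+k-2}{k}$ for some $k\ge 2$. -/

import Mathlib

open PowerSeries

noncomputable section

namespace FiberConeHVector

/-- A Cohen-Macaulay local ring: a ring with a regular sequence whose length is the Krull dimension.
(Over a local ring, the entries of a regular sequence in Mathlib's sense lie in the maximal ideal.) -/
def IsCohenMacaulayLocal (R : Type*) [CommRing R] [IsLocalRing R] : Prop :=
  IsNoetherianRing R ∧
    ∃ rs : List R, RingTheory.Sequence.IsRegular R rs ∧
      ((rs.length : ℕ∞) : WithBot ℕ∞) = ringKrullDim R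

/-- A Cohen-Macaulay ring: a Noetherian ring all of whose localizations at prime ideals are
Cohen-Macaulay local rings. -/
def IsCohenMacaulay (R : Type*) [CommRing R] : Prop :=
  IsNoetherianRing R ∧
    ∀ (p : Ideal R) [p.IsPrime], IsCohenMacaulayLocal (Localization.AtPrime p)

variable {K : Type*} [Field K] {n : ℕ}

/-- A graded (homogeneous) ideal of `K[x₁, …, xₙ]`, with the standard grading `deg xᵢ = 1`. -/
def IsGradedIdeal (I : Ideal (MvPolynomial (Fin n) K)) : Prop :=
  letI := MvPolynomial.gradedAlgebra (σ := Fin n) (R := K)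
  I.IsHomogeneous (MvPolynomial.homogeneousSubmodule (Fin n) K)

/-- The minimal number of generators `μ(I)`. -/
abbrev mu (I : Ideal (MvPolynomial (Fin n) K)) : ℕ :=
  Submodule.spanFinrank I

variable (K n) in
/-- The graded maximal ideal `𝔪 = (x₁, …, xₙ)` of `K[x₁, …, xₙ]`. -/
abbrev gradedMaximalIdeal : Ideal (MvPolynomial (Fin n) K) :=
  Ideal.span (Set.range MvPolynomial.X)

/-- The fiber cone `F(I) = ⨁ₖ Iᵏ / 𝔪 Iᵏ`, as the quotient `R(I) / 𝔪 R(I)` of the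
Rees algebra `R(I) = ⨁ₖ Iᵏ tᵏ`. -/
abbrev FiberCone (I : Ideal (MvPolynomial (Fin n) K)) : Type _ :=
  (reesAlgebra I) ⧸
    Ideal.map (algebraMap (MvPolynomial (Fin n) K) (reesAlgebra I)) (gradedMaximalIdeal K n)

/-- The graded component `Iᵏ / 𝔪 Iᵏ` of degree `k` of the fiber cone: the `K`-subspace of
the residue classes of the elements `a tᵏ` (with `a ∈ Iᵏ`) of the Rees algebra. -/
def fiberConeComponent (I : Ideal (MvPolynomial (Fin n) K)) (k : ℕ) :
    Submodule K (FiberCone I) where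
  carrier := {x | ∃ (a : MvPolynomial (Fin n) K) (ha : a ∈ I ^ k),
    x = Ideal.Quotient.mk _ ⟨Polynomial.monomial k a, reesAlgebra.monomial_mem.mpr ha⟩}
  zero_mem' := ⟨0, Ideal.zero_mem _, by
    rw [eq_comm, ← map_zero (Ideal.Quotient.mk _)]
    congr 1
    ext1
    simp⟩
  add_mem' := by
    rintro _ _ ⟨a, ha, rfl⟩ ⟨b, hb, rfl⟩
    refine ⟨a + b, Ideal.add_mem _ ha hb, ?_⟩
    rw [← map_add]
    congr 1
    ext1
    simp
  smul_mem' := by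
    rintro c _ ⟨a, ha, rfl⟩
    refine ⟨c • a, Submodule.smul_of_tower_mem _ c ha, ?_⟩
    rw [← Ideal.Quotient.mkₐ_eq_mk K, ← map_smul]
    congr 1
    ext1
    exact Polynomial.smul_monomial c k a

/-- The Hilbert series `∑ₖ dim_K F(I)ₖ tᵏ` of the fiber cone. -/
def hilbertSeries (I : Ideal (MvPolynomial (Fin n) K)) : PowerSeries ℤ :=
  PowerSeries.mk fun k => (Module.finrank K (fiberConeComponent I k) : ℤ)

/-- The analytic spread `ℓ(I)`, the Krull dimension of the fiber cone. (This dimension is a natural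
number, since the fiber cone is a nonzero finitely generated `K`-algebra.) -/
def analyticSpread (I : Ideal (MvPolynomial (Fin n) K)) : ℕ :=
  ((ringKrullDim (FiberCone I)).unbotD 0).toNat

/-- The coefficient `hᵢ` of `tⁱ` in `Q(t) = (1 - t)^ℓ(I) · Hilb_{F(I)}(t)`. -/
def hCoeff (I : Ideal (MvPolynomial (Fin n) K)) (i : ℕ) : ℤ :=
  PowerSeries.coeff i ((1 - X) ^ analyticSpread I * hilbertSeries I)

/-- `Δ(I) = μ(I²) - ℓ(I) μ(I) + (ℓ(I) choose 2)`. -/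
def Delta (I : Ideal (MvPolynomial (Fin n) K)) : ℤ :=
  (mu (I ^ 2) : ℤ) - (analyticSpread I : ℤ) * (mu I : ℤ) + ((analyticSpread I).choose 2 : ℤ)

end FiberConeHVector

end

-- By graded Nakayama the coefficients of the Hilbert series of F(I) are the numbers μ(Iᵏ). Since h₀
-- = 1 and h₁ = μ(I) - l, write Q = 1 + (μ(I) - l)t + R with R the part of degree at least two.
-- Expanding (1 + (μ(I) - l)t)/(1 - t)^l gives exactly the binomial formula, so the defect of that
-- formula at k is the coefficient of tᵏ in R/(1 - t)^l (`mu_pow_eq`). Part (a) is then positivity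
-- of the coefficients of 1/(1 - t)^l, and part (b) holds because 1/(1 - t)^l is a unit. The case k
-- = 2 reads h₂ = Δ(I).
--
-- Part (c) needs that a Cohen–Macaulay F(I) has h ≥ 0 without internal zeros
-- (`hCoeff_nonneg_of_isCohenMacaulay`). The classical argument divides by a linear system of
-- parameters, for which K must be infinite. Here one divides instead by the generic form θ = ∑ xⱼuʲ
-- over K[u], which is regular by McCoy's theorem as soon as no nonzero element is killed by all xⱼ.
-- Each division multiplies the Hilbert series, now counting ranks over a polynomial ring, by 1 - t
-- (`series_quotientMap`). After l divisions Q is itself the Hilbert series of a standard graded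
-- algebra over a domain, so its coefficients are ranks, and a zero rank forces the next one to
-- vanish.
--
-- That l divisions are possible comes from a regular sequence in the localization at the irrelevant
-- ideal: `HasGenericDepth.succ_of_regular` trades each of its members for a generic form, and
-- `HasGenericDepth.of_nearIso` descends from the localization. The length of the sequence is l
-- because dim F(I) is the height of the irrelevant ideal (`ringKrullDim_fiberCone`).

universe u v

/-! ### Generic forms and generic depth -/

open Polynomial in
/-- The form `∑ xⱼ uʲ` in a new variable `u`. -/
noncomputable def genericForm {N : ℕ} {C : Type u} [CommRing C] (x : Fin N → C) : C[X] :=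
  ∑ j, Polynomial.C (x j) * Polynomial.X ^ (j : ℕ)

/-- The ring `C[u] / (∑ xⱼ uʲ)`. -/
abbrev GenericQuotient {N : ℕ} {C : Type u} [CommRing C] (x : Fin N → C) : Type u :=
  Polynomial C ⧸ Ideal.span {genericForm x}

/-- The images of the elements `xⱼ` in `C[u] / (∑ xⱼ uʲ)`. -/
noncomputable def genericImage {N : ℕ} {C : Type u} [CommRing C] (x : Fin N → C) :
    Fin N → GenericQuotient x :=
  fun j => Ideal.Quotient.mk _ (Polynomial.C (x j))

/-- No nonzero element of `C` is annihilated by all `xⱼ`. -/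
def SocleFree {N : ℕ} {C : Type u} [CommRing C] (x : Fin N → C) : Prop :=
  ∀ c, (∀ j, x j * c = 0) → c = 0

/-- The ideal generated by the `xⱼ` has (true) grade at least `r`: one can divide `r` times by a
generic linear combination of the `xⱼ`, which is a nonzerodivisor each time. -/
def HasGenericDepth {N : ℕ} : ℕ → ∀ {C : Type u} [CommRing C], (Fin N → C) → Prop
  | 0, _, _, _ => True
  | r + 1, _, _, x => SocleFree x ∧ HasGenericDepth r (genericImage x)

section GenericForm

open Polynomial

variable {N : ℕ} {C C' : Type u} [CommRing C] [CommRing C']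

theorem map_genericForm (φ : C →+* C') (x : Fin N → C) :
    (genericForm x).map φ = genericForm (φ ∘ x) := by
  simp [genericForm, Polynomial.map_sum]

theorem coeff_genericForm (x : Fin N → C) (j : Fin N) : (genericForm x).coeff j = x j := by
  simp [genericForm, Polynomial.coeff_X_pow, Fin.val_inj]

/-- McCoy's theorem for the generic form. -/
theorem SocleFree.eq_zero_of_genericForm_mul {x : Fin N → C} (h : SocleFree x) {f : C[X]}
    (hf : genericForm x * f = 0) : f = 0 := by
  by_contra hne
  have : genericForm x ∉ nonZeroDivisors C[X] := fun hm =>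
    hne ((mem_nonZeroDivisors_iff.1 hm).1 f hf)
  obtain ⟨a, ha, hz⟩ := Polynomial.notMem_nonZeroDivisors_iff.1 this
  refine ha (h a fun j => ?_)
  have := congrArg (fun p => Polynomial.coeff p j) hz
  simpa [coeff_genericForm, mul_comm] using this

/-- A ring homomorphism that is bijective up to elements congruent to `1` modulo the `xⱼ`. -/
structure NearIso (φ : C →+* C') (x : Fin N → C) : Prop where
  ker : ∀ c, φ c = 0 → ∃ w, w - 1 ∈ Ideal.span (Set.range x) ∧ w * c = 0
  sur : ∀ c', ∃ w c, w - 1 ∈ Ideal.span (Set.range x) ∧ φ w * c' = φ c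

theorem mul_sub_one_mem {I : Ideal C} {v w : C} (hv : v - 1 ∈ I) (hw : w - 1 ∈ I) :
    v * w - 1 ∈ I := by
  have : v * w - 1 = v * (w - 1) + (v - 1) := by ring
  rw [this]
  exact I.add_mem (I.mul_mem_left _ hw) hv

/-- An element c killed by all xⱼ maps to zero, so some w ≡ 1 modulo the xⱼ kills it; but w - 1
kills it too. -/
theorem SocleFree.of_nearIso {φ : C →+* C'} {x : Fin N → C} (h : NearIso φ x)
    (hs : SocleFree (φ ∘ x)) : SocleFree x := by
  intro c hc
  obtain ⟨w, hw, hwc⟩ := h.ker c (hs _ fun j => by simp [← map_mul, hc])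
  have : ∀ v ∈ Ideal.span (Set.range x), v * c = 0 := by
    intro v hv
    refine Submodule.span_induction ?_ (by simp) ?_ ?_ hv
    · rintro _ ⟨j, rfl⟩; exact hc j
    · intro a b _ _ ha hb; rw [add_mul, ha, hb, add_zero]
    · intro a b _ hb; rw [smul_eq_mul, mul_assoc, hb, mul_zero]
  have h1 := this _ hw
  rw [sub_mul, hwc] at h1
  simpa using h1

/-- The map on generic quotients induced by a ring homomorphism. -/
noncomputable def genericMap (φ : C →+* C') (x : Fin N → C) :
    GenericQuotient x →+* GenericQuotient (φ ∘ x) :=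
  Ideal.quotientMap _ (Polynomial.mapRingHom φ) (by
    rw [Ideal.span_singleton_le_iff_mem, Ideal.mem_comap, coe_mapRingHom, map_genericForm]
    exact Ideal.mem_span_singleton_self _)

theorem genericMap_comp_genericImage (φ : C →+* C') (x : Fin N → C) :
    genericMap φ x ∘ genericImage x = genericImage (φ ∘ x) := by
  ext j
  simp [genericMap, genericImage]

theorem mk_C_sub_one_mem {x : Fin N → C} {w : C} (hw : w - 1 ∈ Ideal.span (Set.range x)) :
    (Ideal.Quotient.mk (Ideal.span {genericForm x}) (Polynomial.C w)) - 1 ∈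
      Ideal.span (Set.range (genericImage x)) := by
  have := Ideal.mem_map_of_mem
    ((Ideal.Quotient.mk (Ideal.span {genericForm x})).comp (Polynomial.C)) hw
  rw [Ideal.map_span, ← Set.range_comp] at this
  simpa using! this

/-- A polynomial has finitely many coefficients, so a product of the individual multipliers is a
common denominator. -/
theorem NearIso.exists_C_mul_eq_map {φ : C →+* C'} {x : Fin N → C} (h : NearIso φ x)
    (f' : C'[X]) : ∃ (w : C) (f : C[X]), w - 1 ∈ Ideal.span (Set.range x) ∧
      Polynomial.C (φ w) * f' = f.map φ := by
  induction f' using Polynomial.induction_on' with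
  | add p q hp hq =>
    obtain ⟨v, f, hv, hf⟩ := hp
    obtain ⟨w, g, hw, hg⟩ := hq
    refine ⟨v * w, Polynomial.C w * f + Polynomial.C v * g, mul_sub_one_mem hv hw, ?_⟩
    simp only [map_mul, Polynomial.map_add, Polynomial.map_mul, Polynomial.map_C, ← hf, ← hg]
    ring
  | monomial n a =>
    obtain ⟨w, c, hw, hc⟩ := h.sur a
    exact ⟨w, monomial n c, hw, by rw [Polynomial.C_mul_monomial, hc, map_monomial]⟩

theorem NearIso.exists_C_mul_eq_zero {φ : C →+* C'} {x : Fin N → C} (h : NearIso φ x)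
    (f : C[X]) (hf : f.map φ = 0) : ∃ w, w - 1 ∈ Ideal.span (Set.range x) ∧
      Polynomial.C w * f = 0 := by
  have key : ∀ s : Finset ℕ, ∃ w, w - 1 ∈ Ideal.span (Set.range x) ∧
      ∀ i ∈ s, w * f.coeff i = 0 := by
    intro s
    induction s using Finset.induction_on with
    | empty => exact ⟨1, by simp, by simp⟩
    | insert i s _ ih =>
      obtain ⟨v, hv, hvs⟩ := ih
      obtain ⟨w, hw, hwi⟩ := h.ker (f.coeff i) (by
        have := congrArg (fun p => Polynomial.coeff p i) hf
        simpa using this)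
      refine ⟨v * w, mul_sub_one_mem hv hw, fun k hk => ?_⟩
      rcases Finset.mem_insert.1 hk with rfl | hk
      · rw [mul_assoc, hwi, mul_zero]
      · rw [mul_right_comm, hvs k hk, zero_mul]
  obtain ⟨w, hw, hws⟩ := key f.support
  refine ⟨w, hw, ?_⟩
  ext i
  by_cases hi : i ∈ f.support
  · simpa using hws i hi
  · simp [notMem_support_iff.1 hi]

/-- Clearing denominators coefficientwise lets the property survive division by the generic form,
which drives the induction on depth. -/
theorem NearIso.genericMap {φ : C →+* C'} {x : Fin N → C} (h : NearIso φ x) :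
    NearIso (genericMap φ x) (genericImage x) where
  ker := by
    intro c hc
    obtain ⟨f, rfl⟩ := Ideal.Quotient.mk_surjective c
    rw [_root_.genericMap, Ideal.quotientMap_mk, Ideal.Quotient.eq_zero_iff_mem,
      Ideal.mem_span_singleton] at hc
    obtain ⟨g', hg'⟩ := hc
    obtain ⟨w, g, hw, hg⟩ := h.exists_C_mul_eq_map g'
    obtain ⟨v, hv, hv0⟩ := h.exists_C_mul_eq_zero (Polynomial.C w * f - genericForm x * g) (by
      rw [coe_mapRingHom] at hg'
      rw [Polynomial.map_sub, Polynomial.map_mul, Polynomial.map_mul, map_genericForm, hg', ← hg,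
        Polynomial.map_C]
      ring)
    refine ⟨Ideal.Quotient.mk _ (Polynomial.C (v * w)),
      mk_C_sub_one_mem (mul_sub_one_mem hv hw), ?_⟩
    rw [← map_mul, Ideal.Quotient.eq_zero_iff_mem, Ideal.mem_span_singleton]
    refine ⟨Polynomial.C v * g, ?_⟩
    rw [mul_sub, sub_eq_zero] at hv0
    rw [map_mul, mul_assoc, hv0]
    ring
  sur := by
    intro c'
    obtain ⟨f', rfl⟩ := Ideal.Quotient.mk_surjective c'
    obtain ⟨w, f, hw, hf⟩ := h.exists_C_mul_eq_map f'
    refine ⟨Ideal.Quotient.mk _ (Polynomial.C w), Ideal.Quotient.mk _ f, mk_C_sub_one_mem hw, ?_⟩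
    rw [_root_.genericMap, Ideal.quotientMap_mk, Ideal.quotientMap_mk, ← map_mul]
    simp [hf]

/-- The intended φ is localization at a maximal ideal generated by the xⱼ: an element outside that
ideal has a multiple congruent to 1 modulo it. -/
theorem HasGenericDepth.of_nearIso {r : ℕ} : ∀ {C C' : Type u} [CommRing C] [CommRing C']
    {φ : C →+* C'} {x : Fin N → C}, NearIso φ x → HasGenericDepth r (φ ∘ x) →
    HasGenericDepth r x := by
  induction r with
  | zero => intros; trivial
  | succ r ih =>
    intro C C' _ _ φ x h hd
    exact ⟨hd.1.of_nearIso h, ih h.genericMap (by rw [genericMap_comp_genericImage]; exact hd.2)⟩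

/-- The natural map `(C[u]/θ)/y → (C/y)[u]/θ`. -/
noncomputable def genericQuotientSwap (x : Fin N → C) (y : C) :
    (GenericQuotient x ⧸ Ideal.span {Ideal.Quotient.mk (Ideal.span {genericForm x})
      (Polynomial.C y)}) →+* GenericQuotient (Ideal.Quotient.mk (Ideal.span {y}) ∘ x) :=
  Ideal.Quotient.lift _ (genericMap (Ideal.Quotient.mk (Ideal.span {y})) x) (by
    intro a ha
    obtain ⟨b, rfl⟩ := Ideal.mem_span_singleton.1 ha
    rw [map_mul, genericMap, Ideal.quotientMap_mk, coe_mapRingHom, Polynomial.map_C,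
      Ideal.Quotient.eq_zero_iff_mem.2 (Ideal.mem_span_singleton_self y)]
    simp)

/-- Dividing by y and by θ commutes; the map is bijective, so the multipliers can all be taken to be
1. -/
theorem nearIso_genericQuotientSwap (x : Fin N → C) (y : C) :
    NearIso (genericQuotientSwap x y) (Ideal.Quotient.mk (Ideal.span
      {Ideal.Quotient.mk (Ideal.span {genericForm x}) (Polynomial.C y)}) ∘ genericImage x) where
  ker := by
    intro c hc
    suffices h : c = 0 from ⟨1, by simp, by subst h; grind⟩
    obtain ⟨c, rfl⟩ := Ideal.Quotient.mk_surjective c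
    obtain ⟨f, rfl⟩ := Ideal.Quotient.mk_surjective c
    rw [genericQuotientSwap, Ideal.Quotient.lift_mk, genericMap, Ideal.quotientMap_mk,
      Ideal.Quotient.eq_zero_iff_mem, Ideal.mem_span_singleton] at hc
    obtain ⟨g', hg'⟩ := hc
    obtain ⟨g, rfl⟩ := Polynomial.map_surjective _ Ideal.Quotient.mk_surjective g'
    rw [coe_mapRingHom, ← map_genericForm, ← Polynomial.map_mul, ← sub_eq_zero,
      ← Polynomial.map_sub] at hg'
    have hk : f - genericForm x * g ∈
        RingHom.ker (mapRingHom (Ideal.Quotient.mk (Ideal.span {y}))) :=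
      hg'
    rw [Polynomial.ker_mapRingHom, Ideal.mk_ker, Ideal.map_span, Set.image_singleton,
      Ideal.mem_span_singleton] at hk
    obtain ⟨d, hd⟩ := hk
    rw [Ideal.Quotient.eq_zero_iff_mem, Ideal.mem_span_singleton]
    refine ⟨Ideal.Quotient.mk _ d, ?_⟩
    rw [← map_mul, Ideal.Quotient.eq, Ideal.mem_span_singleton]
    exact ⟨g, by rw [← hd]; ring⟩
  sur := by
    intro c'
    obtain ⟨f', rfl⟩ := Ideal.Quotient.mk_surjective c'
    obtain ⟨f, rfl⟩ := Polynomial.map_surjective _ Ideal.Quotient.mk_surjective f'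
    exact ⟨1, Ideal.Quotient.mk _ (Ideal.Quotient.mk _ f), by simp,
      by simp [genericQuotientSwap, genericMap]⟩

theorem SocleFree.of_regular {x : Fin N → C} {y : C} (hy : y ∈ Ideal.span (Set.range x))
    (hreg : ∀ c, y * c = 0 → c = 0) : SocleFree x := by
  intro c hc
  refine hreg c ?_
  refine Submodule.span_induction ?_ (by simp) ?_ ?_ hy
  · rintro _ ⟨j, rfl⟩; exact hc j
  · intro a b _ _ ha hb; rw [add_mul, ha, hb, add_zero]
  · intro a b _ hb; rw [smul_eq_mul, mul_assoc, hb, mul_zero]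

/-- Generic depth goes up when a regular element of the ideal is lifted. -/
theorem HasGenericDepth.succ_of_regular {r : ℕ} : ∀ {C : Type u} [CommRing C]
    {x : Fin N → C} {y : C}, y ∈ Ideal.span (Set.range x) → (∀ c, y * c = 0 → c = 0) →
    HasGenericDepth r (Ideal.Quotient.mk (Ideal.span {y}) ∘ x) → HasGenericDepth (r + 1) x := by
  induction r with
  | zero => intro C _ x y hy hreg _; exact ⟨.of_regular hy hreg, trivial⟩
  | succ r ih =>
    intro C _ x y hy hreg hd
    refine ⟨.of_regular hy hreg, ih (y := Ideal.Quotient.mk _ (Polynomial.C y)) ?_ ?_ ?_⟩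
    · have := Ideal.mem_map_of_mem
        ((Ideal.Quotient.mk (Ideal.span {genericForm x})).comp (Polynomial.C)) hy
      rw [Ideal.map_span, ← Set.range_comp] at this
      exact this
    · intro c hc
      obtain ⟨f, rfl⟩ := Ideal.Quotient.mk_surjective c
      rw [← map_mul, Ideal.Quotient.eq_zero_iff_mem, Ideal.mem_span_singleton] at hc
      obtain ⟨g, hg⟩ := hc
      -- Regularity of y modulo θ: from y f = θ g, reducing modulo y and applying McCoy over C/y
      -- gives y ∣ g. Cancelling y then gives θ ∣ f.
      have hg0 : g.map (Ideal.Quotient.mk (Ideal.span {y})) = 0 := by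
        refine hd.1.eq_zero_of_genericForm_mul ?_
        rw [← map_genericForm, ← Polynomial.map_mul, ← hg, Polynomial.map_mul, Polynomial.map_C,
          Ideal.Quotient.eq_zero_iff_mem.2 (Ideal.mem_span_singleton_self y), map_zero, zero_mul]
      have hk : g ∈ RingHom.ker (mapRingHom (Ideal.Quotient.mk (Ideal.span {y}))) := hg0
      rw [Polynomial.ker_mapRingHom, Ideal.mk_ker, Ideal.map_span, Set.image_singleton,
        Ideal.mem_span_singleton] at hk
      obtain ⟨d, rfl⟩ := hk
      rw [Ideal.Quotient.eq_zero_iff_mem, Ideal.mem_span_singleton]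
      refine ⟨d, ?_⟩
      have h0 : Polynomial.C y * (f - genericForm x * d) = 0 := by rw [mul_sub, hg]; ring
      rw [← sub_eq_zero]
      ext i
      refine hreg _ ?_
      simpa using congrArg (fun p => Polynomial.coeff p i) h0
    -- Modulo y, the quotient C[u]/θ becomes (C/y)[u]/θ, where the depth hypothesis applies.
    · refine HasGenericDepth.of_nearIso (nearIso_genericQuotientSwap x y) ?_
      have : genericQuotientSwap x y ∘ (Ideal.Quotient.mk _ ∘ genericImage x) =
          genericImage (Ideal.Quotient.mk (Ideal.span {y}) ∘ x) := by
        ext j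
        simp [genericQuotientSwap, genericMap, genericImage]
      rw [this]
      exact hd.2

open RingTheory.Sequence Pointwise in
/-- A weakly regular sequence in the ideal of the `xⱼ` bounds the generic depth below. -/
theorem hasGenericDepth_of_isWeaklyRegular {B : Type u} [CommRing B] (rs : List B) :
    ∀ {C : Type u} [CommRing C] [Algebra B C] (x : Fin N → C),
      IsWeaklyRegular C rs → (∀ b ∈ rs, algebraMap B C b ∈ Ideal.span (Set.range x)) →
      HasGenericDepth rs.length x := by
  induction rs with
  | nil => intros; trivial
  | cons b rs ih =>
    intro C _ _ x hreg hmem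
    rw [isWeaklyRegular_cons_iff] at hreg
    refine HasGenericDepth.succ_of_regular (y := algebraMap B C b) (hmem b (by simp)) ?_ ?_
    · intro c hc
      rw [← Algebra.smul_def] at hc
      exact hreg.1.right_eq_zero_of_smul hc
    · refine ih _ ?_ ?_
      · let I : Ideal C := Ideal.span {algebraMap B C b}
        have he : b • (⊤ : Submodule B C) = I.restrictScalars B := by
          ext c
          rw [Submodule.mem_smul_pointwise_iff_exists, Submodule.restrictScalars_mem,
            Ideal.mem_span_singleton]
          constructor
          · rintro ⟨d, -, rfl⟩; exact ⟨d, by rw [Algebra.smul_def]⟩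
          · rintro ⟨d, rfl⟩; exact ⟨d, trivial, by rw [Algebra.smul_def]⟩
        let e : QuotSMulTop b C ≃ₗ[B] (C ⧸ I) :=
          (Submodule.quotEquivOfEq _ _ he).trans (Submodule.Quotient.restrictScalarsEquiv B I)
        exact (e.isWeaklyRegular_congr rs).1 hreg.2
      · intro a ha
        have := Ideal.mem_map_of_mem (Ideal.Quotient.mk (Ideal.span {algebraMap B C b}))
          (hmem a (by simp [ha]))
        rw [Ideal.map_span, ← Set.range_comp] at this
        exact this

end GenericForm

/-! ### Ranks of graded components after division by a generic form -/

section HilbertFunction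

open Polynomial

/-- Projections `π k` of a `T`-algebra `C` onto the graded components of a grading for which `C` is
generated by the elements `xⱼ` of degree one over its component of degree zero. -/
structure IsStandardGrading {N : ℕ} {T : Type v} {C : Type u} [CommRing T] [CommRing C]
    [Algebra T C] (x : Fin N → C) (π : ℕ → C →ₗ[T] C) : Prop where
  idem : ∀ k c, π k (π k c) = π k c
  map_mul_succ : ∀ k j c, π (k + 1) (x j * c) = x j * π k c
  map_mul_zero : ∀ j c, π 0 (x j * c) = 0
  fg_zero : (LinearMap.range (π 0)).FG
  exists_eq_sum : ∀ k c, ∃ d : Fin N → C, π (k + 1) c = ∑ j, x j * π k (d j)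

variable {N : ℕ} {T : Type v} {C : Type u} [CommRing T] [CommRing C] [Algebra T C]
  {x : Fin N → C} {π : ℕ → C →ₗ[T] C}

namespace IsStandardGrading

theorem fg_range (h : IsStandardGrading x π) (k : ℕ) : (LinearMap.range (π k)).FG := by
  induction k with
  | zero => exact h.fg_zero
  | succ k ih =>
    have : LinearMap.range (π (k + 1)) =
        ⨆ j, (LinearMap.range (π k)).map (LinearMap.mulLeft T (x j)) := by
      apply le_antisymm
      · rintro _ ⟨c, rfl⟩
        obtain ⟨d, hd⟩ := h.exists_eq_sum k c
        rw [hd]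
        exact Submodule.sum_mem _ fun j _ => Submodule.mem_iSup_of_mem j ⟨_, ⟨d j, rfl⟩, rfl⟩
      · refine iSup_le fun j => ?_
        rintro _ ⟨_, ⟨d, rfl⟩, rfl⟩
        exact ⟨x j * d, h.map_mul_succ k j d⟩
    rw [this]
    exact Submodule.fg_iSup _ fun j => ih.map _

/-- Rank zero over a domain means torsion. The next component is spanned by the xⱼ-multiples of this
one, and a product of annihilators of the finitely many terms kills their sum. -/
theorem finrank_range_succ_eq_zero [IsDomain T] (h : IsStandardGrading x π) {k : ℕ}
    (hk : Module.finrank T (LinearMap.range (π k)) = 0) :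
    Module.finrank T (LinearMap.range (π (k + 1))) = 0 := by
  have hf := Module.Finite.iff_fg.2 (h.fg_range k)
  have hf' := Module.Finite.iff_fg.2 (h.fg_range (k + 1))
  rw [Module.finrank_eq_zero_iff] at hk ⊢
  rintro ⟨_, c, rfl⟩
  obtain ⟨d, hd⟩ := h.exists_eq_sum k c
  choose a ha0 ha using fun j => hk ⟨π k (d j), d j, rfl⟩
  refine ⟨∏ j, a j, Finset.prod_ne_zero_iff.2 fun j _ => ha0 j, ?_⟩
  ext
  simp only [Submodule.coe_smul, hd, Finset.smul_sum, Submodule.coe_zero]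
  refine Finset.sum_eq_zero fun j _ => ?_
  have h1 : a j • π k (d j) = 0 := congrArg Subtype.val (ha j)
  rw [← Finset.prod_erase_mul _ _ (Finset.mem_univ j), mul_smul, ← mul_smul_comm, h1]
  simp

attribute [local instance] Polynomial.algebra

theorem isBaseChange_polynomial :
    IsBaseChange T[X] (IsScalarTower.toAlgHom T C C[X]).toLinearMap :=
  Algebra.IsPushout.out

/-- Coefficientwise extension of a linear endomorphism to polynomials. -/
noncomputable def polyMap (f : C →ₗ[T] C) : C[X] →ₗ[T[X]] C[X] :=
  isBaseChange_polynomial.lift ((IsScalarTower.toAlgHom T C C[X]).toLinearMap ∘ₗ f)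

@[simp]
theorem polyMap_C (f : C →ₗ[T] C) (c : C) :
    polyMap f (Polynomial.C c) = Polynomial.C (f c) :=
  isBaseChange_polynomial.lift_eq _ c

theorem polyMap_map_mul (f : C →ₗ[T] C) (s : T[X]) (p : C[X]) :
    polyMap f (s.map (algebraMap T C) * p) = s.map (algebraMap T C) * polyMap f p := by
  have := (polyMap f).map_smul s p
  rwa [Algebra.smul_def, Algebra.smul_def] at this

@[simp]
theorem polyMap_monomial (f : C →ₗ[T] C) (n : ℕ) (c : C) :
    polyMap f (Polynomial.monomial n c) = Polynomial.monomial n (f c) := by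
  have := polyMap_map_mul f (Polynomial.X ^ n) (Polynomial.C c)
  rw [polyMap_C] at this
  rwa [Polynomial.map_pow, Polynomial.map_X, Polynomial.X_pow_mul,
    Polynomial.C_mul_X_pow_eq_monomial, Polynomial.X_pow_mul,
    Polynomial.C_mul_X_pow_eq_monomial] at this

theorem monomial_mul_genericForm (x : Fin N → C) (n : ℕ) (c : C) :
    genericForm x * Polynomial.monomial n c =
      ∑ j : Fin N, Polynomial.monomial ((j : ℕ) + n) (x j * c) := by
  simp only [genericForm, Finset.sum_mul, Polynomial.C_mul_X_pow_eq_monomial,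
    Polynomial.monomial_mul_monomial]

/-- With u in degree zero, θ is homogeneous of degree one; this is what lets the grading descend to
the quotient by θ. -/
theorem polyMap_genericForm_mul (h : IsStandardGrading x π) (k : ℕ) (g : C[X]) :
    polyMap (π (k + 1)) (genericForm x * g) = genericForm x * polyMap (π k) g := by
  induction g using Polynomial.induction_on' with
  | monomial n c => simp [monomial_mul_genericForm, h.map_mul_succ]
  | add p q hp hq => rw [mul_add, map_add, hp, hq, map_add, mul_add]

theorem polyMap_zero_genericForm_mul (h : IsStandardGrading x π) (g : C[X]) :
    polyMap (π 0) (genericForm x * g) = 0 := by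
  induction g using Polynomial.induction_on' with
  | monomial n c => simp [monomial_mul_genericForm, h.map_mul_zero]
  | add p q hp hq => rw [mul_add, map_add, hp, hq, add_zero]

/-- The projections of the grading of `C[u] / (∑ xⱼ uʲ)` over `T[u]`. -/
noncomputable def quotientMap (h : IsStandardGrading x π) (k : ℕ) :
    GenericQuotient x →ₗ[T[X]] GenericQuotient x :=
  ((Ideal.span {genericForm x}).restrictScalars T[X]).mapQ
    ((Ideal.span {genericForm x}).restrictScalars T[X]) (polyMap (π k)) (by
    intro f hf
    obtain ⟨g, rfl⟩ := Ideal.mem_span_singleton.1 hf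
    rw [Submodule.mem_comap, Submodule.restrictScalars_mem, Ideal.mem_span_singleton]
    cases k with
    | zero => rw [h.polyMap_zero_genericForm_mul]; exact dvd_zero _
    | succ k => rw [h.polyMap_genericForm_mul]; exact dvd_mul_right _ _)

@[simp]
theorem quotientMap_mk (h : IsStandardGrading x π) (k : ℕ) (f : C[X]) :
    h.quotientMap k (Ideal.Quotient.mk _ f) = Ideal.Quotient.mk _ (polyMap (π k) f) :=
  rfl

theorem polyMap_idem (h : IsStandardGrading x π) (k : ℕ) (f : C[X]) :
    polyMap (π k) (polyMap (π k) f) = polyMap (π k) f := by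
  induction f using Polynomial.induction_on' with
  | monomial n c => simp [h.idem]
  | add p q hp hq => rw [map_add, map_add, hp, hq]

/-- The range of `polyMap f` is the base change of the range of `f`. -/
noncomputable def rangeEquiv (f : C →ₗ[T] C) :
    TensorProduct T T[X] (LinearMap.range f) ≃ₗ[T[X]] LinearMap.range (polyMap f) :=
  (Submodule.toBaseChange.toLinearEquiv T[X] (LinearMap.range f)).trans <|
    (isBaseChange_polynomial.equiv.submoduleMap _).trans <| LinearEquiv.ofEq _ _ (by
      apply le_antisymm
      · rw [Submodule.map_le_iff_le_comap, Submodule.baseChange_eq_span, Submodule.span_le]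
        rintro _ ⟨_, ⟨c, rfl⟩, rfl⟩
        refine ⟨Polynomial.C c, ?_⟩
        rw [polyMap_C]
        simp [IsBaseChange.equiv_tmul]
      · rintro _ ⟨g, rfl⟩
        induction g using Polynomial.induction_on' with
        | monomial n c =>
          refine ⟨(Polynomial.X ^ n) ⊗ₜ f c, Submodule.tmul_mem_baseChange_of_mem _ ⟨c, rfl⟩, ?_⟩
          rw [polyMap_monomial]
          simp [IsBaseChange.equiv_tmul, Algebra.smul_def, Polynomial.X_pow_mul,
            Polynomial.C_mul_X_pow_eq_monomial]
        | add p q hp hq => rw [map_add]; exact Submodule.add_mem _ hp hq)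

theorem finrank_range_polyMap [IsDomain T] (f : C →ₗ[T] C) :
    Module.finrank T[X] (LinearMap.range (polyMap f)) = Module.finrank T (LinearMap.range f) := by
  rw [← (rangeEquiv f).finrank_eq]
  exact (TensorProduct.isBaseChange T (LinearMap.range f) T[X]).finrank_eq

/-- This makes the construction repeatable, with T[u] as the new base. -/
theorem genericQuotient (h : IsStandardGrading x π) :
    IsStandardGrading (genericImage x) h.quotientMap where
  idem := by
    intro k c
    obtain ⟨f, rfl⟩ := Ideal.Quotient.mk_surjective c
    simp [h.polyMap_idem]
  map_mul_succ := by
    intro k j c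
    obtain ⟨f, rfl⟩ := Ideal.Quotient.mk_surjective c
    rw [genericImage, ← map_mul, quotientMap_mk, quotientMap_mk, ← map_mul]
    congr 1
    induction f using Polynomial.induction_on' with
    | monomial n c => simp [Polynomial.C_mul_monomial, h.map_mul_succ]
    | add p q hp hq => rw [mul_add, map_add, hp, hq, map_add, mul_add]
  map_mul_zero := by
    intro j c
    obtain ⟨f, rfl⟩ := Ideal.Quotient.mk_surjective c
    rw [genericImage, ← map_mul, quotientMap_mk]
    have : polyMap (π 0) (Polynomial.C (x j) * f) = 0 := by
      induction f using Polynomial.induction_on' with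
      | monomial n c => simp [Polynomial.C_mul_monomial, h.map_mul_zero]
      | add p q hp hq => rw [mul_add, map_add, hp, hq, add_zero]
    rw [this, map_zero]
  fg_zero := by
    have h1 : (LinearMap.range (polyMap (π 0))).FG := by
      have := Module.Finite.iff_fg.2 h.fg_zero
      exact Module.Finite.iff_fg.1 (Module.Finite.equiv (rangeEquiv (π 0)))
    have h2 := h1.map (((Ideal.span {genericForm x}).restrictScalars T[X]).mkQ)
    convert! h2 using 1
    ext c
    constructor
    · rintro ⟨c, rfl⟩
      obtain ⟨f, rfl⟩ := Ideal.Quotient.mk_surjective c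
      exact ⟨_, ⟨f, rfl⟩, rfl⟩
    · rintro ⟨_, ⟨f, rfl⟩, rfl⟩
      exact ⟨Ideal.Quotient.mk _ f, rfl⟩
  exists_eq_sum := by
    intro k c
    obtain ⟨f, rfl⟩ := Ideal.Quotient.mk_surjective c
    suffices ∃ d : Fin N → C[X],
        polyMap (π (k + 1)) f = ∑ j, Polynomial.C (x j) * polyMap (π k) (d j) by
      obtain ⟨d, hd⟩ := this
      refine ⟨fun j => Ideal.Quotient.mk _ (d j), ?_⟩
      simp only [quotientMap_mk, hd, map_sum, map_mul, genericImage]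
    induction f using Polynomial.induction_on' with
    | monomial n c =>
      obtain ⟨d, hd⟩ := h.exists_eq_sum k c
      exact ⟨fun j => Polynomial.monomial n (d j), by simp [hd, Polynomial.C_mul_monomial]⟩
    | add p q hp hq =>
      obtain ⟨d, hd⟩ := hp
      obtain ⟨e, he⟩ := hq
      exact ⟨d + e, by simp [hd, he, mul_add, Finset.sum_add_distrib]⟩

theorem finite_range_polyMap (h : IsStandardGrading x π) (k : ℕ) :
    Module.Finite T[X] (LinearMap.range (polyMap (π k))) := by
  have := Module.Finite.iff_fg.2 (h.fg_range k)
  exact Module.Finite.equiv (rangeEquiv (π k))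

/-- Reduction modulo the generic form, on a graded component. -/
noncomputable def rangeMk (h : IsStandardGrading x π) (k : ℕ) :
    LinearMap.range (polyMap (π k)) →ₗ[T[X]] LinearMap.range (h.quotientMap k) :=
  (((Ideal.span {genericForm x}).restrictScalars T[X]).mkQ).restrict (by
    rintro _ ⟨f, rfl⟩
    exact ⟨Ideal.Quotient.mk _ f, rfl⟩)

theorem rangeMk_surjective (h : IsStandardGrading x π) (k : ℕ) :
    Function.Surjective (h.rangeMk k) := by
  rintro ⟨_, c, rfl⟩
  obtain ⟨f, rfl⟩ := Ideal.Quotient.mk_surjective c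
  exact ⟨⟨_, f, rfl⟩, rfl⟩

theorem mem_ker_rangeMk (h : IsStandardGrading x π) (k : ℕ) (f : LinearMap.range (polyMap (π k))) :
    f ∈ LinearMap.ker (h.rangeMk k) ↔ ∃ g, (f : C[X]) = genericForm x * g := by
  rw [LinearMap.mem_ker, Subtype.ext_iff]
  change Ideal.Quotient.mk (Ideal.span {genericForm x}) (f : C[X]) = 0 ↔ _
  rw [Ideal.Quotient.eq_zero_iff_mem, Ideal.mem_span_singleton]
  rfl

theorem finrank_range_quotientMap_zero [IsDomain T] (h : IsStandardGrading x π) :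
    Module.finrank T[X] (LinearMap.range (h.quotientMap 0)) =
      Module.finrank T (LinearMap.range (π 0)) := by
  rw [← finrank_range_polyMap (π 0)]
  refine (LinearEquiv.ofBijective (h.rangeMk 0) ⟨?_, h.rangeMk_surjective 0⟩).finrank_eq.symm
  rw [← LinearMap.ker_eq_bot, eq_bot_iff]
  rintro ⟨_, f, rfl⟩ hf
  obtain ⟨g, hg⟩ := (h.mem_ker_rangeMk 0 _).1 hf
  rw [Submodule.mem_bot]
  ext1
  change polyMap (π 0) f = 0
  rw [← h.polyMap_idem]
  exact (congrArg _ hg).trans (h.polyMap_zero_genericForm_mul g)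

/-- Rank additivity for 0 → Cₖ[u] → Cₖ₊₁[u] → (C[u]/θ)ₖ₊₁ → 0, where the first map is multiplication
by θ, injective by McCoy. -/
theorem finrank_range_quotientMap_succ [IsDomain T] (h : IsStandardGrading x π) (hs : SocleFree x)
    (k : ℕ) :
    Module.finrank T[X] (LinearMap.range (h.quotientMap (k + 1))) +
      Module.finrank T (LinearMap.range (π k)) =
      Module.finrank T (LinearMap.range (π (k + 1))) := by
  have := h.finite_range_polyMap (k + 1)
  have key := (LinearMap.ker (h.rangeMk (k + 1))).finrank_quotient_add_finrank
  rw [((h.rangeMk (k + 1)).quotKerEquivOfSurjective (h.rangeMk_surjective (k + 1))).finrank_eq]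
    at key
  rw [← finrank_range_polyMap (π k), ← finrank_range_polyMap (π (k + 1)), ← key]
  congr 1
  let m : LinearMap.range (polyMap (π k)) →ₗ[T[X]] LinearMap.range (polyMap (π (k + 1))) :=
    (LinearMap.mulLeft T[X] (genericForm x)).restrict (by
      rintro _ ⟨g, rfl⟩
      exact ⟨genericForm x * g, h.polyMap_genericForm_mul k g⟩)
  have hm : Function.Injective m := by
    rw [← LinearMap.ker_eq_bot, eq_bot_iff]
    intro g hg
    have h1 : genericForm x * (g : C[X]) = 0 := congrArg Subtype.val hg
    exact Subtype.ext (hs.eq_zero_of_genericForm_mul h1)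
  have hr : LinearMap.range m = LinearMap.ker (h.rangeMk (k + 1)) := by
    ext f
    rw [mem_ker_rangeMk]
    constructor
    · rintro ⟨g, rfl⟩
      exact ⟨g, rfl⟩
    · obtain ⟨_, f, rfl⟩ := f
      rintro ⟨g, hg⟩
      -- The cofactor g need not be homogeneous; its degree-k component serves as well.
      refine ⟨⟨polyMap (π k) g, g, rfl⟩, Subtype.ext ?_⟩
      change genericForm x * polyMap (π k) g = polyMap (π (k + 1)) f
      rw [← h.polyMap_genericForm_mul, ← h.polyMap_idem (k + 1) f]
      exact congrArg _ hg.symm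
  rw [← hr]
  exact (LinearEquiv.ofInjective m hm).finrank_eq

/-- The Hilbert series of a standard grading. -/
noncomputable def series (π : ℕ → C →ₗ[T] C) : PowerSeries ℤ :=
  PowerSeries.mk fun k => (Module.finrank T (LinearMap.range (π k)) : ℤ)

theorem series_quotientMap [IsDomain T] (h : IsStandardGrading x π) (hs : SocleFree x) :
    series h.quotientMap = (1 - PowerSeries.X) * series π := by
  ext k
  rw [sub_mul, one_mul, map_sub]
  cases k with
  | zero => simp [series, h.finrank_range_quotientMap_zero]
  | succ k =>
    rw [PowerSeries.coeff_succ_X_mul]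
    simp only [series, PowerSeries.coeff_mk]
    have := h.finrank_range_quotientMap_succ hs k
    omega

end IsStandardGrading

/-- If the generic depth is at least `r`, then `(1 - t) ^ r` times the Hilbert series is the
Hilbert series of a standard graded algebra. -/
theorem IsStandardGrading.coeff_series {r : ℕ} : ∀ {T : Type v} {C : Type u} [CommRing T]
    [IsDomain T] [CommRing C] [Algebra T C] {x : Fin N → C} {π : ℕ → C →ₗ[T] C},
    IsStandardGrading x π → HasGenericDepth r x → ∀ i,
    0 ≤ PowerSeries.coeff i ((1 - PowerSeries.X) ^ r * IsStandardGrading.series π) ∧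
    (PowerSeries.coeff i ((1 - PowerSeries.X) ^ r * IsStandardGrading.series π) = 0 →
      PowerSeries.coeff (i + 1) ((1 - PowerSeries.X) ^ r * IsStandardGrading.series π) = 0) := by
  induction r with
  | zero =>
    intro T C _ _ _ _ x π h _ i
    simp only [pow_zero, one_mul, IsStandardGrading.series, PowerSeries.coeff_mk]
    exact ⟨Int.natCast_nonneg _, fun h0 => by
      exact_mod_cast h.finrank_range_succ_eq_zero (by exact_mod_cast h0)⟩
  | succ r ih =>
    intro T C _ _ _ _ x π h hd i
    -- The induction hypothesis is applied over T[u], which is again a domain.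
    let := Polynomial.algebra T C
    have := ih h.genericQuotient hd.2 i
    rwa [h.series_quotientMap hd.1, ← mul_assoc, ← pow_succ] at this

end HilbertFunction

/-! ### Dimension as the height of a maximal ideal -/

section Dimension

/-- Induction on the number of variables: a maximal ideal of R[X] contracts to a maximal ideal of
the Jacobson ring R, and its height is one more than that of the contraction. -/
theorem natCast_le_height_mvPolynomial {k : Type*} [Field k] (s : ℕ) :
    ∀ (M : Ideal (MvPolynomial (Fin s) k)) [M.IsMaximal], (s : ℕ∞) ≤ M.height := by
  induction s with
  | zero => simp
  | succ s ih =>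
    intro M hM
    let e := (MvPolynomial.finSuccEquiv k s).toRingEquiv
    rw [← RingEquiv.height_comap e.symm M]
    have hP : (M.comap e.symm).IsMaximal := Ideal.comap_isMaximal_of_equiv e.symm
    have hp : ((M.comap e.symm).comap Polynomial.C).IsMaximal :=
      Polynomial.isMaximal_comap_C_of_isJacobsonRing _
    have : (M.comap e.symm).LiesOver ((M.comap e.symm).comap Polynomial.C) := ⟨rfl⟩
    rw [Polynomial.height_eq_height_add_one ((M.comap e.symm).comap Polynomial.C)]
    push_cast
    gcongr
    exact ih _

/-- In an affine domain, every maximal ideal has height at least the dimension. -/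
theorem ringKrullDim_le_height_of_isMaximal (k : Type*) {D : Type*} [Field k] [CommRing D]
    [IsDomain D] [Algebra k D] [Algebra.FiniteType k D] (M : Ideal D) [M.IsMaximal] :
    ringKrullDim D ≤ M.height := by
  -- Noether normalization: incomparability bounds the dimension by s, and going down carries height
  -- at least s from the polynomial ring up to M.
  obtain ⟨s, g, hg, hint⟩ := exists_integral_inj_algHom_of_fg k D
  algebraize [g.toRingHom]
  have : FaithfulSMul (MvPolynomial (Fin s) k) D := (faithfulSMul_iff_algebraMap_injective _ _).2 hg
  have : Algebra.IsIntegral (MvPolynomial (Fin s) k) D := ⟨hint⟩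
  have : IsNoetherianRing D := Algebra.FiniteType.isNoetherianRing k D
  have h1 : ringKrullDim D ≤ s := by
    have : StrictMono (PrimeSpectrum.comap (algebraMap (MvPolynomial (Fin s) k) D)) :=
      fun p q hpq => Ideal.IsIntegral.comap_lt_comap (R := MvPolynomial (Fin s) k) hpq
    refine (Order.krullDim_le_of_strictMono _ this).trans ?_
    change ringKrullDim _ ≤ _
    simp
  refine h1.trans ?_
  have : M.LiesOver (M.under (MvPolynomial (Fin s) k)) := ⟨rfl⟩
  rw [Ideal.height_eq_height_add_of_liesOver_of_hasGoingDown (M.under (MvPolynomial (Fin s) k)) M]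
  have h2 := natCast_le_height_mvPolynomial s (M.under (MvPolynomial (Fin s) k))
  exact_mod_cast h2.trans le_self_add

/-- If every prime ideal of an affine algebra contains a prime ideal contained in the maximal
ideal `m`, then the dimension is the height of `m`. -/
theorem ringKrullDim_le_height_of_forall_exists_le (k : Type*) {F : Type*} [Field k] [CommRing F]
    [Algebra k F] [Algebra.FiniteType k F] (m : Ideal F) [hm : m.IsMaximal]
    (h : ∀ p : Ideal F, p.IsPrime → ∃ q : Ideal F, q.IsPrime ∧ q ≤ p ∧ q ≤ m) :
    ringKrullDim F ≤ m.height := by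
  rw [ringKrullDim, Order.krullDim]
  refine iSup_le fun l => ?_
  -- A chain starting at p lives in the affine domain F/q, whose dimension is at most the height of
  -- m/q.
  obtain ⟨q, hq, hqp, hqm⟩ := h l.head.asIdeal l.head.isPrime
  have hsurj : Function.Surjective (Ideal.Quotient.mk q) := Ideal.Quotient.mk_surjective
  have hker : RingHom.ker (Ideal.Quotient.mk q) ≤ m := by rwa [Ideal.mk_ker]
  have hmax : (m.map (Ideal.Quotient.mk q)).IsMaximal :=
    Ideal.IsMaximal.map_of_surjective_of_ker_le hsurj hker
  have h1 : (l.length : WithBot ℕ∞) ≤ ringKrullDim (F ⧸ q) := by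
    rw [ringKrullDim_quotient]
    let l' : LTSeries (PrimeSpectrum.zeroLocus (q : Set F)) :=
      { length := l.length
        toFun := fun i => ⟨l i, fun x hx => l.head_le i (hqp hx)⟩
        step := fun i => l.step i }
    exact Order.LTSeries.length_le_krullDim l'
  refine h1.trans ((ringKrullDim_le_height_of_isMaximal k (m.map (Ideal.Quotient.mk q))).trans ?_)
  have h2 := Order.height_le_height_apply_of_strictMono _
    (RingHom.strictMono_comap_of_surjective hsurj) ⟨m.map (Ideal.Quotient.mk q), hmax.isPrime⟩
  have h3 : PrimeSpectrum.comap (Ideal.Quotient.mk q) ⟨m.map (Ideal.Quotient.mk q), hmax.isPrime⟩ =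
      ⟨m, hm.isPrime⟩ := by
    ext1
    simp only [PrimeSpectrum.comap_asIdeal]
    rw [Ideal.comap_map_of_surjective' _ hsurj, sup_eq_left.2 hker]
  rw [h3, ← PrimeSpectrum.height_eq_orderHeight, ← PrimeSpectrum.height_eq_orderHeight] at h2
  exact_mod_cast h2

/-- The homogeneous core of a prime ideal, for a grading given by a coaction `δ`. -/
theorem exists_isPrime_le_of_coaction {F : Type*} [CommRing F] (δ : F →+* Polynomial F)
    (hδ : ∀ c, (δ c).eval 1 = c) (m : Ideal F)
    (hm : ∀ c p, Ideal.IsPrime p → (δ c).coeff 0 ∈ p → c ∈ m) (p : Ideal F) (hp : p.IsPrime) :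
    ∃ q : Ideal F, q.IsPrime ∧ q ≤ p ∧ q ≤ m := by
  have hP : (p.map Polynomial.C).IsPrime := Ideal.isPrime_map_C_of_isPrime
  -- The preimage of p[X] consists of the elements all of whose components lie in p.
  refine ⟨(p.map Polynomial.C).comap δ, hP.comap δ, fun c hc => ?_, fun c hc => ?_⟩
  · rw [Ideal.mem_comap, Ideal.mem_map_C_iff] at hc
    rw [← hδ c, Polynomial.eval_eq_sum]
    exact Ideal.sum_mem _ fun i _ => by simpa using hc i
  · rw [Ideal.mem_comap, Ideal.mem_map_C_iff] at hc
    exact hm c p hp (hc 0)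

end Dimension

/-! ### Graded Nakayama lemma -/

section GradedNakayama

open MvPolynomial

theorem Ideal.exists_eq_sum_of_mem_span_range_mul {S : Type*} [CommRing S] {N : ℕ} (g : Fin N → S)
    (J : Ideal S) {a : S} (ha : a ∈ Ideal.span (Set.range g) * J) :
    ∃ b : Fin N → S, (∀ j, b j ∈ J) ∧ a = ∑ j, g j * b j := by
  induction ha using Submodule.mul_induction_on' with
  | mem_mul_mem r hr s hs =>
    obtain ⟨c, rfl⟩ := Ideal.mem_span_range_iff_exists_fun.1 hr
    refine ⟨fun j => c j * s, fun j => J.mul_mem_left _ hs, ?_⟩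
    rw [Finset.sum_mul]
    exact Finset.sum_congr rfl fun j _ => by ring
  | add x _ y _ hx hy =>
    obtain ⟨b, hb, rfl⟩ := hx
    obtain ⟨c, hc, rfl⟩ := hy
    exact ⟨b + c, fun j => J.add_mem (hb j) (hc j), by simp [mul_add, Finset.sum_add_distrib]⟩

variable {K : Type*} [Field K] {n : ℕ}

attribute [local instance] MvPolynomial.gradedAlgebra

theorem homogeneousComponent_eq_decompose (d : ℕ) (p : MvPolynomial (Fin n) K) :
    homogeneousComponent d p = DirectSum.decompose (homogeneousSubmodule (Fin n) K) p d :=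
  (decomposition.decompose'_apply p d).symm

theorem homogeneousComponent_zero_X_mul (j : Fin n) (p : MvPolynomial (Fin n) K) :
    homogeneousComponent 0 (MvPolynomial.X j * p) = 0 := by
  rw [homogeneousComponent_eq_decompose]
  exact DirectSum.coe_decompose_mul_of_left_mem_of_not_le _ (isHomogeneous_X K j) (by simp)

theorem homogeneousComponent_succ_X_mul (d : ℕ) (j : Fin n) (p : MvPolynomial (Fin n) K) :
    homogeneousComponent (d + 1) (MvPolynomial.X j * p) =
      MvPolynomial.X j * homogeneousComponent d p := by
  ext s
  rw [coeff_homogeneousComponent, MvPolynomial.coeff_X_mul', MvPolynomial.coeff_X_mul',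
    coeff_homogeneousComponent]
  by_cases hj : j ∈ s.support
  · have hs : s.degree = (s - Finsupp.single j 1).degree + 1 := by
      have h1 : Finsupp.single j 1 ≤ s := by
        rw [Finsupp.single_le_iff]
        exact Nat.one_le_iff_ne_zero.2 (Finsupp.mem_support_iff.1 hj)
      conv_lhs => rw [← tsub_add_cancel_of_le h1]
      simp
    simp only [hj, if_true, hs, Nat.add_right_cancel_iff]
  · simp [hj]

theorem isHomogeneous_pow {I : Ideal (MvPolynomial (Fin n) K)}
    (hI : I.IsHomogeneous (homogeneousSubmodule (Fin n) K)) (k : ℕ) :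
    (I ^ k).IsHomogeneous (homogeneousSubmodule (Fin n) K) := by
  induction k with
  | zero => rw [pow_zero, Ideal.one_eq_top]; exact Ideal.IsHomogeneous.top _
  | succ k ih => rw [pow_succ]; exact ih.mul hI

/-- The graded Nakayama lemma for homogeneous ideals of a polynomial ring. -/
theorem le_span_range_of_forall_exists_sub_mem {J : Ideal (MvPolynomial (Fin n) K)}
    {r : ℕ} {a : Fin r → MvPolynomial (Fin n) K} {d : Fin r → ℕ}
    (had : ∀ i, (a i).IsHomogeneous (d i))
    (h : ∀ b ∈ J, ∃ c : Fin r → K,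
      b - ∑ i, c i • a i ∈
        Ideal.span (Set.range (MvPolynomial.X : Fin n → MvPolynomial (Fin n) K)) * J) :
    J ≤ Ideal.span (Set.range a) := by
  have hcomp : ∀ e i, homogeneousComponent e (a i) ∈ Ideal.span (Set.range a) := by
    intro e i
    rw [homogeneousComponent_of_mem ((mem_homogeneousSubmodule _ _).2 (had i))]
    split_ifs
    · exact Ideal.subset_span ⟨i, rfl⟩
    · exact Ideal.zero_mem _
  -- Induction on the degree: an element of 𝔪J has no component in degree zero, and its component in
  -- degree e + 1 only involves degree-e components of elements of J.
  have key : ∀ e, ∀ b ∈ J, homogeneousComponent e b ∈ Ideal.span (Set.range a) := by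
    intro e
    induction e with
    | zero =>
      intro b hb
      obtain ⟨c, hc⟩ := h b hb
      obtain ⟨q, -, hq⟩ := Ideal.exists_eq_sum_of_mem_span_range_mul _ _ hc
      rw [sub_eq_iff_eq_add] at hq
      rw [hq, map_add, map_sum, map_sum]
      simp only [homogeneousComponent_zero_X_mul, Finset.sum_const_zero, zero_add, map_smul]
      exact Ideal.sum_mem _ fun i _ => Submodule.smul_of_tower_mem _ _ (hcomp 0 i)
    | succ e ih =>
      intro b hb
      obtain ⟨c, hc⟩ := h b hb
      obtain ⟨q, hqJ, hq⟩ := Ideal.exists_eq_sum_of_mem_span_range_mul _ _ hc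
      rw [sub_eq_iff_eq_add] at hq
      rw [hq, map_add, map_sum, map_sum]
      simp only [homogeneousComponent_succ_X_mul, map_smul]
      exact Ideal.add_mem _ (Ideal.sum_mem _ fun j _ => Ideal.mul_mem_left _ _ (ih _ (hqJ j)))
        (Ideal.sum_mem _ fun i _ => Submodule.smul_of_tower_mem _ _ (hcomp (e + 1) i))
  intro b hb
  rw [← sum_homogeneousComponent b]
  exact Ideal.sum_mem _ fun e _ => key e b hb

end GradedNakayama

/-! ### The fiber cone as a standard graded algebra -/

namespace FiberConeHVector

section FiberCone

variable {K : Type u} [Field K] {n : ℕ} (I : Ideal (MvPolynomial (Fin n) K))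

/-- The ring structure of the fiber cone. -/
noncomputable abbrev fiberConeCommRing : CommRing (FiberCone I) := Ideal.Quotient.commRing _

/-- The semiring structure of the fiber cone. -/
noncomputable abbrev fiberConeCommSemiring : CommSemiring (FiberCone I) :=
  (fiberConeCommRing I).toCommSemiring

/-- The semiring structure of the fiber cone. -/
noncomputable abbrev fiberConeSemiring : Semiring (FiberCone I) :=
  (fiberConeCommSemiring I).toSemiring

attribute [local instance] fiberConeCommRing fiberConeSemiring fiberConeCommSemiring

/-- The element `a tᵏ` of the Rees algebra. -/
noncomputable def reesMonomial (k : ℕ) :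
    (I ^ k : Ideal (MvPolynomial (Fin n) K)) →ₗ[MvPolynomial (Fin n) K] reesAlgebra I where
  toFun a := ⟨Polynomial.monomial k a, reesAlgebra.monomial_mem.mpr a.2⟩
  map_add' a b := by ext1; simp
  map_smul' c a := by ext1; simp [Polynomial.smul_monomial]

/-- The coefficient of `tᵏ` of an element of the Rees algebra. -/
noncomputable def reesCoeff (k : ℕ) :
    reesAlgebra I →ₗ[MvPolynomial (Fin n) K] (I ^ k : Ideal (MvPolynomial (Fin n) K)) where
  toFun r := ⟨(r : Polynomial _).coeff k, (mem_reesAlgebra_iff I _).1 r.2 k⟩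
  map_add' a b := by ext1; simp
  map_smul' c a := by ext1; simp

/-- The ideal `𝔪 R(I)` of the Rees algebra. -/
noncomputable abbrev reesMaximalMap : Ideal (reesAlgebra I) :=
  Ideal.map (algebraMap (MvPolynomial (Fin n) K) (reesAlgebra I)) (gradedMaximalIdeal K n)

/-- Written as 𝔪 • ⊤, the ideal is respected by every S-linear map, in particular by coefficient
extraction. -/
theorem reesMaximalMap_restrictScalars :
    (reesMaximalMap I).restrictScalars (MvPolynomial (Fin n) K) =
      gradedMaximalIdeal K n • (⊤ : Submodule (MvPolynomial (Fin n) K) (reesAlgebra I)) :=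
  (Ideal.smul_top_eq_map _).symm

theorem reesMonomial_comp_reesCoeff_mem (k : ℕ) {r : reesAlgebra I} (hr : r ∈ reesMaximalMap I) :
    reesMonomial I k (reesCoeff I k r) ∈ reesMaximalMap I := by
  have h1 := Submodule.smul_top_le_comap_smul_top (gradedMaximalIdeal K n)
    (reesMonomial I k ∘ₗ reesCoeff I k)
  rw [← reesMaximalMap_restrictScalars] at h1
  exact h1 hr

theorem coeff_mem_of_mem_reesMaximalMap (k : ℕ) {r : reesAlgebra I} (hr : r ∈ reesMaximalMap I) :
    (r : Polynomial (MvPolynomial (Fin n) K)).coeff k ∈ gradedMaximalIdeal K n * I ^ k := by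
  have h2 := Submodule.smul_top_le_comap_smul_top (gradedMaximalIdeal K n) (reesCoeff I k)
  rw [← reesMaximalMap_restrictScalars] at h2
  have h3 := Submodule.mem_map_of_mem (f := Submodule.subtype (I ^ k))
    (Submodule.mem_comap.1 (h2 hr))
  rw [Submodule.map_smul'', Submodule.map_top, Submodule.range_subtype] at h3
  exact h3

/-- The residue class of an element of the Rees algebra in the fiber cone. -/
noncomputable abbrev fiberMk : reesAlgebra I →+* FiberCone I := Ideal.Quotient.mk _

/-- The projection of the fiber cone onto its component of degree `k`. -/
noncomputable def fiberProj (k : ℕ) : FiberCone I →ₗ[K] FiberCone I :=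
  (((reesMaximalMap I).restrictScalars (MvPolynomial (Fin n) K)).mapQ
    ((reesMaximalMap I).restrictScalars (MvPolynomial (Fin n) K))
    (reesMonomial I k ∘ₗ reesCoeff I k)
    (fun _ hr => reesMonomial_comp_reesCoeff_mem I k hr)).restrictScalars K

theorem fiberProj_mk (k : ℕ) (r : reesAlgebra I) :
    fiberProj I k (fiberMk I r) = fiberMk I (reesMonomial I k (reesCoeff I k r)) :=
  rfl

theorem range_fiberProj (k : ℕ) : LinearMap.range (fiberProj I k) = fiberConeComponent I k := by
  ext c
  constructor
  · rintro ⟨c, rfl⟩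
    obtain ⟨r, rfl⟩ := Ideal.Quotient.mk_surjective c
    exact ⟨_, (reesCoeff I k r).2, rfl⟩
  · rintro ⟨a, ha, rfl⟩
    refine ⟨fiberMk I ⟨Polynomial.monomial k a, reesAlgebra.monomial_mem.mpr ha⟩, ?_⟩
    rw [fiberProj_mk]
    congr 1
    ext1
    simp [reesMonomial, reesCoeff]

/-- The augmentation of the Rees algebra onto the residue field. -/
noncomputable def reesAugmentation : reesAlgebra I →+* K :=
  (MvPolynomial.constantCoeff.comp Polynomial.constantCoeff).comp (reesAlgebra I).subtype

theorem constantCoeff_eq_zero_of_mem {p : MvPolynomial (Fin n) K}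
    (hp : p ∈ gradedMaximalIdeal K n) : MvPolynomial.constantCoeff p = 0 := by
  have : gradedMaximalIdeal K n ≤ RingHom.ker (MvPolynomial.constantCoeff (R := K)) := by
    rw [gradedMaximalIdeal, Ideal.span_le]
    rintro _ ⟨j, rfl⟩
    simp
  exact this hp

theorem sub_C_constantCoeff_mem (p : MvPolynomial (Fin n) K) :
    p - MvPolynomial.C (MvPolynomial.constantCoeff p) ∈ gradedMaximalIdeal K n := by
  induction p using MvPolynomial.induction_on with
  | C a => simp
  | add p q hp hq =>
    rw [map_add, map_add, add_sub_add_comm]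
    exact Ideal.add_mem _ hp hq
  | mul_X p j _ =>
    simp only [map_mul, MvPolynomial.constantCoeff_X, mul_zero, map_zero, sub_zero]
    exact Ideal.mul_mem_left _ _ (Ideal.subset_span ⟨j, rfl⟩)

/-- The augmentation of the fiber cone onto the residue field. -/
noncomputable def augmentation : FiberCone I →+* K :=
  Ideal.Quotient.lift _ (reesAugmentation I) (by
    intro r hr
    have := coeff_mem_of_mem_reesMaximalMap I 0 hr
    rw [pow_zero, mul_one] at this
    exact constantCoeff_eq_zero_of_mem this)

theorem augmentation_mk (r : reesAlgebra I) :
    augmentation I (fiberMk I r) =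
      MvPolynomial.constantCoeff ((r : Polynomial (MvPolynomial (Fin n) K)).coeff 0) :=
  rfl

/-- Since 𝔪 acts as zero on the fiber cone, a polynomial acts through its constant term. -/
theorem fiberMk_smul (p : MvPolynomial (Fin n) K) (r : reesAlgebra I) :
    fiberMk I (p • r) = MvPolynomial.constantCoeff p • fiberMk I r := by
  have h1 : (p - MvPolynomial.C (MvPolynomial.constantCoeff p)) • r ∈ reesMaximalMap I := by
    rw [Algebra.smul_def]
    exact Ideal.mul_mem_right _ _ (Ideal.mem_map_of_mem _ (sub_C_constantCoeff_mem p))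
  have h2 : p • r = (p - MvPolynomial.C (MvPolynomial.constantCoeff p)) • r +
      MvPolynomial.constantCoeff p • r := by
    ext1
    change p • (r : Polynomial (MvPolynomial (Fin n) K)) =
      (p - MvPolynomial.C (MvPolynomial.constantCoeff p)) • (r : Polynomial _) +
        MvPolynomial.constantCoeff p • (r : Polynomial _)
    ext1 i
    simp only [Polynomial.coeff_add, Polynomial.coeff_smul, MvPolynomial.smul_eq_C_mul, smul_eq_mul]
    ring
  rw [h2, map_add, Ideal.Quotient.eq_zero_iff_mem.2 h1, zero_add]
  rfl

theorem fiberProj_zero (c : FiberCone I) :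
    fiberProj I 0 c = algebraMap K (FiberCone I) (augmentation I c) := by
  obtain ⟨r, rfl⟩ := Ideal.Quotient.mk_surjective c
  have h1 : reesMonomial I 0 (reesCoeff I 0 r) =
      (r : Polynomial (MvPolynomial (Fin n) K)).coeff 0 • (1 : reesAlgebra I) := by
    ext1
    simp [reesMonomial, reesCoeff, Algebra.smul_def]
  rw [fiberProj_mk, h1, fiberMk_smul, augmentation_mk, map_one]
  exact (Algebra.algebraMap_eq_smul_one _).symm

theorem augmentation_algebraMap (a : K) : augmentation I (algebraMap K _ a) = a := by
  have : algebraMap K (FiberCone I) a = fiberMk I (algebraMap K (reesAlgebra I) a) := rfl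
  rw [this, augmentation_mk]
  simp [Polynomial.algebraMap_apply]

theorem augmentation_surjective : Function.Surjective (augmentation I) :=
  fun a => ⟨_, augmentation_algebraMap I a⟩

/-- The projections are multiplicative. -/
theorem fiberProj_mul (k : ℕ) (c d : FiberCone I) :
    fiberProj I k (c * d) =
      ∑ ij ∈ Finset.HasAntidiagonal.antidiagonal k, fiberProj I ij.1 c * fiberProj I ij.2 d := by
  obtain ⟨r, rfl⟩ := Ideal.Quotient.mk_surjective c
  obtain ⟨s, rfl⟩ := Ideal.Quotient.mk_surjective d
  rw [← map_mul, fiberProj_mk]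
  simp only [fiberProj_mk, ← map_mul, ← map_sum]
  congr 1
  ext1
  simp only [reesMonomial, reesCoeff, LinearMap.coe_mk, AddHom.coe_mk,
    AddSubmonoidClass.coe_finsetSum,
    MulMemClass.coe_mul, Polynomial.monomial_mul_monomial, Polynomial.coeff_mul, map_sum]
  refine Finset.sum_congr rfl fun ij hij => ?_
  rw [Finset.HasAntidiagonal.mem_antidiagonal.1 hij]

theorem fiberProj_fiberProj (j k : ℕ) (c : FiberCone I) :
    fiberProj I j (fiberProj I k c) = if j = k then fiberProj I k c else 0 := by
  obtain ⟨r, rfl⟩ := Ideal.Quotient.mk_surjective c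
  rw [fiberProj_mk, fiberProj_mk]
  split_ifs with h
  · subst h
    congr 1
    ext1
    simp [reesMonomial, reesCoeff]
  · rw [← map_zero (fiberMk I)]
    congr 1
    ext1
    simp [reesMonomial, reesCoeff, Polynomial.coeff_monomial, Ne.symm h]

theorem exists_sum_fiberProj (c : FiberCone I) :
    ∃ N, (∀ k, N ≤ k → fiberProj I k c = 0) ∧ c = ∑ k ∈ Finset.range N, fiberProj I k c := by
  obtain ⟨r, rfl⟩ := Ideal.Quotient.mk_surjective c
  refine ⟨(r : Polynomial (MvPolynomial (Fin n) K)).natDegree + 1, fun k hk => ?_, ?_⟩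
  · rw [fiberProj_mk, ← map_zero (fiberMk I)]
    congr 1
    ext1
    simp [reesMonomial, reesCoeff, Polynomial.coeff_eq_zero_of_natDegree_lt hk]
  · simp only [fiberProj_mk, ← map_sum]
    congr 1
    ext1
    simp only [reesMonomial, reesCoeff, LinearMap.coe_mk, AddHom.coe_mk,
      AddSubmonoidClass.coe_finsetSum]
    exact Polynomial.as_sum_range _

section Generators

variable {I} {N : ℕ} {g : Fin N → MvPolynomial (Fin n) K} (hg : Ideal.span (Set.range g) = I)

/-- The elements `gⱼ t` of degree one of the fiber cone. -/
noncomputable def degreeOne (hg : Ideal.span (Set.range g) = I) (j : Fin N) : FiberCone I :=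
  fiberMk I (reesMonomial I 1 ⟨g j, by rw [pow_one, ← hg]; exact Ideal.subset_span ⟨j, rfl⟩⟩)

theorem fiberProj_degreeOne (j : Fin N) (k : ℕ) :
    fiberProj I k (degreeOne hg j) = if k = 1 then degreeOne hg j else 0 := by
  have : degreeOne hg j = fiberProj I 1 (degreeOne hg j) := by
    rw [degreeOne, fiberProj_mk]
    congr 1
    ext1
    simp [reesMonomial, reesCoeff]
  rw [this, fiberProj_fiberProj]

theorem isStandardGrading_fiberProj :
    IsStandardGrading (T := K) (degreeOne hg) (fiberProj I) where
  idem k c := by simp [fiberProj_fiberProj]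
  map_mul_succ k j c := by
    rw [fiberProj_mul, Finset.sum_eq_single (1, k)]
    · rw [fiberProj_degreeOne, if_pos rfl]
    · rintro ⟨a, b⟩ hab hne
      rw [Finset.HasAntidiagonal.mem_antidiagonal] at hab
      rw [fiberProj_degreeOne, if_neg, zero_mul]
      rintro rfl
      exact hne (Prod.ext rfl (by simpa [add_comm] using hab))
    · intro h
      exact absurd (Finset.HasAntidiagonal.mem_antidiagonal.2 (add_comm 1 k)) h
  map_mul_zero j c := by
    rw [fiberProj_mul, Finset.HasAntidiagonal.antidiagonal_zero, Finset.sum_singleton,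
      fiberProj_degreeOne, if_neg zero_ne_one, zero_mul]
  fg_zero := by
    have h : LinearMap.range (fiberProj I 0) ≤ K ∙ (1 : FiberCone I) := by
      rintro _ ⟨c, rfl⟩
      rw [fiberProj_zero, Algebra.algebraMap_eq_smul_one]
      exact Submodule.smul_mem _ _ (Submodule.mem_span_singleton_self _)
    have := Submodule.finiteDimensional_of_le h
    exact Module.Finite.iff_fg.1 this
  exists_eq_sum k c := by
    obtain ⟨r, rfl⟩ := Ideal.Quotient.mk_surjective c
    have h1 : ((reesCoeff I (k + 1) r : (I ^ (k + 1) : Ideal _)) : MvPolynomial (Fin n) K) ∈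
        Ideal.span (Set.range g) * I ^ k := by
      rw [hg, ← pow_succ']
      exact (reesCoeff I (k + 1) r).2
    obtain ⟨b, hb, hs⟩ := Ideal.exists_eq_sum_of_mem_span_range_mul _ _ h1
    refine ⟨fun j => fiberMk I (reesMonomial I k ⟨b j, hb j⟩), ?_⟩
    simp only [fiberProj_mk, degreeOne, ← map_mul, ← map_sum]
    congr 1
    ext1
    simp [reesMonomial, reesCoeff, Polynomial.monomial_mul_monomial] at hs ⊢
    rw [hs, map_sum, add_comm k 1]

theorem span_degreeOne : Ideal.span (Set.range (degreeOne hg)) = RingHom.ker (augmentation I) := by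
  apply le_antisymm
  · rw [Ideal.span_le]
    rintro _ ⟨j, rfl⟩
    rw [SetLike.mem_coe, RingHom.mem_ker, degreeOne, augmentation_mk]
    simp [reesMonomial, Polynomial.coeff_monomial]
  · intro c hc
    obtain ⟨M, -, hM⟩ := exists_sum_fiberProj I c
    rw [hM]
    refine Ideal.sum_mem _ fun k _ => ?_
    cases k with
    | zero => rw [fiberProj_zero, RingHom.mem_ker.1 hc, map_zero]; exact Ideal.zero_mem _
    | succ k =>
      obtain ⟨d, hd⟩ := (isStandardGrading_fiberProj hg).exists_eq_sum k c
      rw [hd]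
      exact Ideal.sum_mem _ fun j _ => Ideal.mul_mem_right _ _ (Ideal.subset_span ⟨j, rfl⟩)

end Generators

/-- The polynomial whose coefficients are the homogeneous components of an element. -/
noncomputable def componentPolynomial (c : FiberCone I) : Polynomial (FiberCone I) :=
  ∑ k ∈ Finset.range (exists_sum_fiberProj I c).choose, Polynomial.monomial k (fiberProj I k c)

theorem coeff_componentPolynomial (c : FiberCone I) (k : ℕ) :
    (componentPolynomial I c).coeff k = fiberProj I k c := by
  simp only [componentPolynomial, Polynomial.finsetSum_coeff, Polynomial.coeff_monomial,
    Finset.sum_ite_eq', Finset.mem_range]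
  split_ifs with h
  · rfl
  · exact ((exists_sum_fiberProj I c).choose_spec.1 k (not_lt.1 h)).symm

theorem eval_componentPolynomial (c : FiberCone I) : (componentPolynomial I c).eval 1 = c := by
  rw [componentPolynomial, Polynomial.eval_finsetSum]
  simp only [Polynomial.eval_monomial, one_pow, mul_one]
  exact (exists_sum_fiberProj I c).choose_spec.2.symm

/-- The coaction of the multiplicative group on the fiber cone that defines its grading. -/
noncomputable def coaction : FiberCone I →+* Polynomial (FiberCone I) where
  toFun := componentPolynomial I
  map_one' := by
    ext k
    rw [coeff_componentPolynomial, Polynomial.coeff_one]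
    have h0 : fiberProj I 0 1 = 1 := by rw [fiberProj_zero, map_one, map_one]
    split_ifs with h
    · rw [h, h0]
    · rw [← h0, fiberProj_fiberProj, if_neg h]
  map_mul' c d := by
    ext k
    rw [coeff_componentPolynomial, fiberProj_mul, Polynomial.coeff_mul]
    simp only [coeff_componentPolynomial]
  map_zero' := by ext k; rw [coeff_componentPolynomial, map_zero, Polynomial.coeff_zero]
  map_add' c d := by
    ext k
    rw [coeff_componentPolynomial, map_add, Polynomial.coeff_add, coeff_componentPolynomial,
      coeff_componentPolynomial]

instance isMaximal_ker_augmentation : (RingHom.ker (augmentation I)).IsMaximal :=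
  RingHom.ker_isMaximal_of_surjective _ (augmentation_surjective I)

theorem finiteType_fiberCone : Algebra.FiniteType K (FiberCone I) := by
  have h1 : Algebra.FiniteType (MvPolynomial (Fin n) K) (reesAlgebra I) :=
    (reesAlgebra I).fg_iff_finiteType.1 (reesAlgebra.fg (IsNoetherian.noetherian I))
  have h2 : Algebra.FiniteType K (reesAlgebra I) := Algebra.FiniteType.trans
    (inferInstanceAs (Algebra.FiniteType K (MvPolynomial (Fin n) K))) h1
  exact Algebra.FiniteType.of_surjective (Ideal.Quotient.mkₐ K _) Ideal.Quotient.mk_surjective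

/-- Every prime contains its homogeneous core, which lies in the irrelevant ideal: the degree-zero
component of an element of the core is a scalar lying in a prime, hence zero. -/
theorem ringKrullDim_fiberCone :
    ringKrullDim (FiberCone I) = (RingHom.ker (augmentation I)).height := by
  have := finiteType_fiberCone I
  refine le_antisymm (ringKrullDim_le_height_of_forall_exists_le K _ ?_)
    (Ideal.height_le_ringKrullDim_of_isPrime)
  refine exists_isPrime_le_of_coaction (coaction I) (eval_componentPolynomial I) _ ?_
  intro c p hp hc
  have h : (coaction I c).coeff 0 = algebraMap K (FiberCone I) (augmentation I c) :=
    (coeff_componentPolynomial I c 0).trans (fiberProj_zero I c)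
  rw [h] at hc
  rw [RingHom.mem_ker]
  by_contra hne
  exact hp.ne_top (Ideal.eq_top_of_isUnit_mem _ hc ((isUnit_iff_ne_zero.2 hne).map _))

end FiberCone

end FiberConeHVector

/-! ### From local depth to generic depth -/

section LocalDepth

open RingTheory.Sequence

/-- A regular sequence in the localization at a maximal ideal generated by the `xⱼ` bounds the
generic depth below. -/
theorem hasGenericDepth_of_isRegular_localization {N : ℕ} {F : Type u} [CommRing F]
    {x : Fin N → F} (m : Ideal F) [hmax : m.IsMaximal] (hm : Ideal.span (Set.range x) = m)
    (rs : List (Localization.AtPrime m)) (hrs : IsRegular (Localization.AtPrime m) rs) :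
    HasGenericDepth rs.length x := by
  have hinv : ∀ s ∉ m, ∃ v, v * s - 1 ∈ Ideal.span (Set.range x) := by
    intro s hs
    obtain ⟨y, i, hi, h⟩ := hmax.exists_inv hs
    exact ⟨y, by rw [hm, ← h, sub_add_cancel_left]; exact m.neg_mem hi⟩
  refine HasGenericDepth.of_nearIso (φ := algebraMap F (Localization.AtPrime m)) ⟨?_, ?_⟩
    (hasGenericDepth_of_isWeaklyRegular rs _ hrs.toIsWeaklyRegular ?_)
  · intro c hc
    obtain ⟨⟨s, hs⟩, hsc⟩ := (IsLocalization.map_eq_zero_iff m.primeCompl _ c).1 hc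
    obtain ⟨v, hv⟩ := hinv s hs
    exact ⟨v * s, hv, by rw [mul_assoc]; exact (congrArg _ hsc).trans (mul_zero v)⟩
  · intro c'
    obtain ⟨⟨c, ⟨s, hs⟩⟩, hsc⟩ := IsLocalization.surj m.primeCompl c'
    obtain ⟨v, hv⟩ := hinv s hs
    refine ⟨v * s, v * c, hv, ?_⟩
    rw [map_mul, map_mul, mul_assoc, ← hsc, mul_comm c']
  · intro b hb
    -- A unit among the entries would make the sequence generate the whole ring, against regularity.
    have h1 : b ∈ IsLocalRing.maximalIdeal (Localization.AtPrime m) := by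
      by_contra hne
      have hu : IsUnit b := by simpa using hne
      refine hrs.top_ne_smul ?_
      rw [Ideal.eq_top_of_isUnit_mem (Ideal.ofList rs) (Ideal.subset_span hb) hu,
        Submodule.top_smul]
    have h2 := congrArg (Ideal.map (algebraMap F (Localization.AtPrime m))) hm
    rw [← Localization.AtPrime.map_eq_maximalIdeal, ← h2, Ideal.map_span, ← Set.range_comp] at h1
    exact h1

end LocalDepth

/-! ### Cohen–Macaulay fiber cones, and μ(Iᵏ) as a Hilbert function -/

namespace FiberConeHVector

section FiberCone

variable {K : Type u} [Field K] {n : ℕ} (I : Ideal (MvPolynomial (Fin n) K))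

attribute [local instance] fiberConeCommRing fiberConeSemiring fiberConeCommSemiring

theorem hilbertSeries_eq_series :
    hilbertSeries I = IsStandardGrading.series (T := K) (fiberProj I) := by
  ext k
  simp only [hilbertSeries, IsStandardGrading.series, PowerSeries.coeff_mk]
  exact congrArg (fun p : Submodule K (FiberCone I) => (Module.finrank K p : ℤ))
    (range_fiberProj I k).symm

variable {I} in
theorem hasGenericDepth_analyticSpread (h : IsCohenMacaulay (FiberCone I)) {N : ℕ}
    {g : Fin N → MvPolynomial (Fin n) K} (hg : Ideal.span (Set.range g) = I) :
    HasGenericDepth (analyticSpread I) (degreeOne hg) := by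
  obtain ⟨-, rs, hrs, hlen⟩ := h.2 (RingHom.ker (augmentation I))
  rw [IsLocalization.AtPrime.ringKrullDim_eq_height (RingHom.ker (augmentation I)),
    ← ringKrullDim_fiberCone I] at hlen
  have : analyticSpread I = rs.length := by
    rw [analyticSpread, ← hlen]
    rfl
  rw [this]
  exact hasGenericDepth_of_isRegular_localization _ (span_degreeOne hg) rs hrs

variable {I} in
/-- The `h`-vector of a Cohen-Macaulay fiber cone is nonnegative, without internal zeros. -/
theorem hCoeff_nonneg_of_isCohenMacaulay (h : IsCohenMacaulay (FiberCone I)) (i : ℕ) :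
    0 ≤ hCoeff I i ∧ (hCoeff I i = 0 → hCoeff I (i + 1) = 0) := by
  obtain ⟨N, g, hg⟩ := Submodule.fg_iff_exists_fin_generating_family.1 (IsNoetherian.noetherian I)
  have := (isStandardGrading_fiberProj hg).coeff_series (hasGenericDepth_analyticSpread h hg) i
  rw [← hilbertSeries_eq_series] at this
  exact this

theorem finrank_fiberConeComponent_zero : Module.finrank K (fiberConeComponent I 0) = 1 := by
  rw [← range_fiberProj]
  have : LinearMap.range (fiberProj I 0) = K ∙ (1 : FiberCone I) := by
    ext c
    rw [Submodule.mem_span_singleton]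
    constructor
    · rintro ⟨c, rfl⟩
      exact ⟨augmentation I c, by rw [fiberProj_zero, Algebra.algebraMap_eq_smul_one]⟩
    · rintro ⟨a, rfl⟩
      refine ⟨a • 1, ?_⟩
      rw [fiberProj_zero, ← Algebra.algebraMap_eq_smul_one, augmentation_algebraMap]
  rw [this]
  refine finrank_span_singleton fun h1 => ?_
  have h2 := congrArg (augmentation I) h1
  rw [map_one, map_zero] at h2
  exact one_ne_zero h2

theorem mem_fiberConeComponent {k : ℕ} {c : FiberCone I} :
    c ∈ fiberConeComponent I k ↔
      ∃ a : (I ^ k : Ideal (MvPolynomial (Fin n) K)), c = fiberMk I (reesMonomial I k a) :=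
  ⟨fun ⟨a, ha, h⟩ => ⟨⟨a, ha⟩, h⟩, fun ⟨a, h⟩ => ⟨a, a.2, h⟩⟩

theorem finite_fiberConeComponent (k : ℕ) : Module.Finite K (fiberConeComponent I k) := by
  obtain ⟨N, g, hg⟩ := Submodule.fg_iff_exists_fin_generating_family.1 (IsNoetherian.noetherian I)
  rw [← range_fiberProj]
  exact Module.Finite.iff_fg.2 ((isStandardGrading_fiberProj hg).fg_range k)

/-- The classes of a minimal generating set of Iᵏ span over K, because S acts through constant
terms. -/
theorem finrank_fiberConeComponent_le_mu (k : ℕ) :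
    Module.finrank K (fiberConeComponent I k) ≤ mu (I ^ k) := by
  obtain ⟨s, hcard, hspan⟩ := (IsNoetherian.noetherian
    (I ^ k)).exists_span_finset_card_eq_spanFinrank
  have hs : ∀ a ∈ s, a ∈ I ^ k := fun a ha => by rw [← hspan]; exact Submodule.subset_span ha
  let v : s → FiberCone I := fun a => fiberMk I (reesMonomial I k ⟨a, hs a a.2⟩)
  have hle : fiberConeComponent I k ≤ Submodule.span K (Set.range v) := by
    intro c hc
    obtain ⟨⟨a, ha⟩, rfl⟩ := (mem_fiberConeComponent I).1 hc
    have hmem : ∀ b, b ∈ Submodule.span (MvPolynomial (Fin n) K) (s : Set _) → b ∈ I ^ k :=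
      fun b hb => by rwa [hspan] at hb
    have ha' := ha
    rw [← hspan] at ha'
    suffices ∀ h : a ∈ I ^ k, fiberMk I (reesMonomial I k ⟨a, h⟩) ∈
      Submodule.span K (Set.range v) from this ha
    clear hc ha
    induction ha' using Submodule.span_induction with
    | mem b hb => exact fun h => Submodule.subset_span ⟨⟨b, hb⟩, rfl⟩
    | zero =>
      intro h
      have : (⟨0, h⟩ : (I ^ k : Ideal (MvPolynomial (Fin n) K))) = 0 := rfl
      rw [this, map_zero, map_zero]
      exact Submodule.zero_mem _
    | add b c hb hc ihb ihc =>
      intro h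
      have : (⟨b + c, h⟩ : (I ^ k : Ideal (MvPolynomial (Fin n) K))) =
        ⟨b, hmem b hb⟩ + ⟨c, hmem c hc⟩ := rfl
      rw [this, map_add, map_add]
      exact Submodule.add_mem _ (ihb _) (ihc _)
    | smul p b hb ihb =>
      intro h
      have : (⟨p • b, h⟩ : (I ^ k : Ideal (MvPolynomial (Fin n) K))) = p • ⟨b, hmem b hb⟩ := rfl
      rw [this, map_smul, fiberMk_smul]
      exact Submodule.smul_mem _ _ (ihb _)
  have := FiniteDimensional.span_of_finite K (Set.finite_range v)
  refine (Submodule.finrank_mono hle).trans ((finrank_range_le_card v).trans ?_)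
  rw [Fintype.card_coe, hcard]

/-- As Iᵏ is homogeneous in S, its component has a K-basis of classes of homogeneous polynomials,
and graded Nakayama turns these into generators of Iᵏ. -/
theorem mu_le_finrank_fiberConeComponent (hI : IsGradedIdeal I) (k : ℕ) :
    mu (I ^ k) ≤ Module.finrank K (fiberConeComponent I k) := by
  let := MvPolynomial.gradedAlgebra (σ := Fin n) (R := K)
  have hJ : (I ^ k).IsHomogeneous (MvPolynomial.homogeneousSubmodule (Fin n) K) :=
    isHomogeneous_pow hI k
  let φ : (I ^ k : Ideal (MvPolynomial (Fin n) K)) → FiberCone I :=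
    fun a => fiberMk I (reesMonomial I k a)
  let s : Set (FiberCone I) := {c | ∃ (a : (I ^ k : Ideal (MvPolynomial (Fin n) K))) (d : ℕ),
    (a : MvPolynomial (Fin n) K).IsHomogeneous d ∧ φ a = c}
  have hspan : Submodule.span K s = fiberConeComponent I k := by
    apply le_antisymm
    · rw [Submodule.span_le]
      rintro _ ⟨a, d, -, rfl⟩
      exact (mem_fiberConeComponent I).2 ⟨a, rfl⟩
    · intro c hc
      obtain ⟨a, rfl⟩ := (mem_fiberConeComponent I).1 hc
      have ha : ∀ d, MvPolynomial.homogeneousComponent d (a : MvPolynomial (Fin n) K) ∈ I ^ k :=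
        (MvPolynomial.mem_iff_homogeneousComponent_mem hJ _).1 a.2
      have : a = ∑ d ∈ Finset.range ((a : MvPolynomial (Fin n) K).totalDegree + 1),
          ⟨MvPolynomial.homogeneousComponent d (a : MvPolynomial (Fin n) K), ha d⟩ := by
        ext1
        rw [AddSubmonoidClass.coe_finsetSum]
        exact (MvPolynomial.sum_homogeneousComponent _).symm
      rw [this, map_sum, map_sum]
      exact Submodule.sum_mem _ fun d _ => Submodule.subset_span
        ⟨_, d, MvPolynomial.homogeneousComponent_isHomogeneous d _, rfl⟩
  have hfin : Module.Finite K (Submodule.span K s) := by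
    rw [hspan]
    exact finite_fiberConeComponent I k
  obtain ⟨f, hfs, hf, -⟩ := Submodule.exists_fun_fin_finrank_span_eq K s
  choose a d had haf using hfs
  have hle : I ^ k ≤ Ideal.span (Set.range fun i => (a i : MvPolynomial (Fin n) K)) := by
    refine le_span_range_of_forall_exists_sub_mem had fun b hb => ?_
    have hb' : φ ⟨b, hb⟩ ∈ Submodule.span K (Set.range f) := by
      rw [hf, hspan]
      exact (mem_fiberConeComponent I).2 ⟨⟨b, hb⟩, rfl⟩
    obtain ⟨c, hc⟩ := (Submodule.mem_span_range_iff_exists_fun K).1 hb'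
    refine ⟨c, ?_⟩
    have h1 : φ (⟨b, hb⟩ - ∑ i, (MvPolynomial.C (c i) : MvPolynomial (Fin n) K) • a i) = 0 := by
      simp only [φ, map_sub, map_sum, map_smul, fiberMk_smul, MvPolynomial.constantCoeff_C]
      rw [sub_eq_zero]
      refine Eq.trans hc.symm (Finset.sum_congr rfl fun i _ => ?_)
      rw [← haf i]
    have h2 := coeff_mem_of_mem_reesMaximalMap I k (Ideal.Quotient.eq_zero_iff_mem.1 h1)
    simpa [reesMonomial, MvPolynomial.smul_eq_C_mul] using h2
  have heq : I ^ k = Submodule.span (MvPolynomial (Fin n) K)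
      (Set.range fun i => (a i : MvPolynomial (Fin n) K)) := by
    refine le_antisymm hle (Ideal.span_le.2 ?_)
    rintro _ ⟨i, rfl⟩
    exact (a i).2
  rw [mu, heq, ← hspan]
  refine (Submodule.spanFinrank_span_le_ncard_of_finite (Set.finite_range _)).trans ?_
  rw [← Set.image_univ]
  refine (Set.ncard_image_le Set.finite_univ).trans ?_
  rw [Set.ncard_univ, Nat.card_fin]

theorem coeff_hilbertSeries (hI : IsGradedIdeal I) (k : ℕ) :
    PowerSeries.coeff k (hilbertSeries I) = mu (I ^ k) := by
  rw [hilbertSeries, PowerSeries.coeff_mk, Nat.cast_inj]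
  exact le_antisymm (finrank_fiberConeComponent_le_mu I k) (mu_le_finrank_fiberConeComponent I hI k)

theorem coeff_zero_hilbertSeries : PowerSeries.coeff 0 (hilbertSeries I) = 1 := by
  rw [hilbertSeries, PowerSeries.coeff_mk, finrank_fiberConeComponent_zero, Nat.cast_one]

end FiberCone

end FiberConeHVector

/-! ### Coefficients of (1 - t)^(-l) -/

section Numerics

namespace PowerSeries

theorem coeff_invOneSubPow_nonneg (l k : ℕ) :
    0 ≤ coeff k (invOneSubPow ℤ l : PowerSeries ℤ) := by
  rcases l with _ | d
  · rw [invOneSubPow_zero, Units.val_one, coeff_one]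
    split_ifs <;> simp
  · simp [invOneSubPow_val_succ_eq_mk_add_choose]

theorem coeff_invOneSubPow_pos {l : ℕ} (hl : 0 < l) (k : ℕ) :
    0 < coeff k (invOneSubPow ℤ l : PowerSeries ℤ) := by
  obtain ⟨d, rfl⟩ := Nat.exists_eq_succ_of_ne_zero hl.ne'
  simp [invOneSubPow_val_succ_eq_mk_add_choose, Nat.choose_pos]

theorem coeff_zero_invOneSubPow (l : ℕ) :
    coeff 0 (invOneSubPow ℤ l : PowerSeries ℤ) = 1 := by
  rcases l with _ | d
  · simp [invOneSubPow_zero]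
  · rw [invOneSubPow_val_succ_eq_mk_add_choose, coeff_mk]; simp

theorem coeff_one_invOneSubPow (l : ℕ) :
    coeff 1 (invOneSubPow ℤ l : PowerSeries ℤ) = l := by
  rcases l with _ | d
  · simp [invOneSubPow_zero, coeff_one]
  · rw [invOneSubPow_val_succ_eq_mk_add_choose, coeff_mk]; simp

theorem invOneSubPow_mul_one_sub_pow (l : ℕ) :
    (invOneSubPow ℤ l : PowerSeries ℤ) * (1 - X) ^ l = 1 := by
  rw [← invOneSubPow_inv_eq_one_sub_pow]
  exact (invOneSubPow ℤ l).val_inv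

/-- The coefficients of `(1 + (m - l) t) / (1 - t) ^ l`. -/
theorem coeff_invOneSubPow_mul_linear (l k : ℕ) (m : ℤ) :
    coeff (k + 1) ((invOneSubPow ℤ l : PowerSeries ℤ) * (1 + C (m - l) * X)) =
      ((l + k - 1).choose k : ℤ) * m - k * ((l + k - 1).choose (k + 1) : ℤ) := by
  rw [mul_add, mul_one, map_add, mul_left_comm, coeff_C_mul, coeff_succ_mul_X]
  -- The case l = 0 is separate: the subtraction in `l + k - 1` truncates at k = 0, and the series
  -- is the constant 1.
  rcases l with _ | d
  · rcases k with _ | k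
    · simp [invOneSubPow_zero, coeff_one]
    · simp [invOneSubPow_zero, coeff_one,
        Nat.choose_eq_zero_of_lt (show k < k + 1 + 1 by omega)]
  · rw [invOneSubPow_val_succ_eq_mk_add_choose, coeff_mk, coeff_mk]
    have h1 : (d + (k + 1)).choose d = (d + k).choose k + (d + k).choose (k + 1) := by
      rw [Nat.choose_symm_add, ← add_assoc, Nat.choose_succ_succ']
    have h2 : (d + k).choose d = (d + k).choose k := by
      rw [Nat.choose_symm_add]
    -- After Pascal's rule, this absorption identity is all that remains of the claim.
    have h3 : ((d + k).choose (k + 1) : ℤ) * (k + 1) = (d + k).choose k * d := by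
      have := Nat.choose_succ_right_eq (d + k) k
      rw [Nat.add_sub_cancel] at this
      exact_mod_cast this
    rw [h1, h2, show d + 1 + k - 1 = d + k by omega]
    push_cast
    linear_combination h3

end PowerSeries

end Numerics

/-! ### The h-vector and the numerical formula -/

namespace FiberConeHVector

section HVector

variable {K : Type*} [Field K] {n : ℕ} (I : Ideal (MvPolynomial (Fin n) K))

theorem hilbertSeries_eq_invOneSubPow_mul :
    hilbertSeries I = (invOneSubPow ℤ (analyticSpread I) : PowerSeries ℤ) *
      PowerSeries.mk (hCoeff I) := by
  have : PowerSeries.mk (hCoeff I) = (1 - X) ^ analyticSpread I * hilbertSeries I := by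
    ext i
    rw [PowerSeries.coeff_mk, hCoeff]
  rw [this, ← mul_assoc, invOneSubPow_mul_one_sub_pow, one_mul]

theorem hCoeff_zero : hCoeff I 0 = 1 := by
  have := coeff_zero_hilbertSeries I
  rwa [hilbertSeries_eq_invOneSubPow_mul, PowerSeries.coeff_mul,
    Finset.Nat.antidiagonal_zero, Finset.sum_singleton, coeff_zero_invOneSubPow,
    PowerSeries.coeff_mk, one_mul] at this

variable {I}

theorem hCoeff_one (hI : IsGradedIdeal I) : hCoeff I 1 = mu I - analyticSpread I := by
  have := coeff_hilbertSeries I hI 1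
  rw [hilbertSeries_eq_invOneSubPow_mul, PowerSeries.coeff_mul,
    Finset.Nat.sum_antidiagonal_succ, Finset.Nat.antidiagonal_zero, Finset.sum_singleton,
    PowerSeries.coeff_mk, PowerSeries.coeff_mk, coeff_zero_invOneSubPow, zero_add,
    coeff_one_invOneSubPow, hCoeff_zero, pow_one] at this
  linarith

variable (I) in
/-- The part of degree at least two of the numerator of the Hilbert series. -/
noncomputable def hTail : PowerSeries ℤ :=
  PowerSeries.mk fun i => if i < 2 then 0 else hCoeff I i

theorem mk_hCoeff (hI : IsGradedIdeal I) :
    PowerSeries.mk (hCoeff I) =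
      1 + PowerSeries.C ((mu I : ℤ) - analyticSpread I) * X + hTail I := by
  ext i
  rw [map_add, map_add, PowerSeries.coeff_C_mul, PowerSeries.coeff_mk, hTail,
    PowerSeries.coeff_mk, PowerSeries.coeff_one, PowerSeries.coeff_X]
  rcases i with _ | _ | i
  · simp [hCoeff_zero]
  · simp [hCoeff_one hI]
  · simp

/-- The defect in the formula for `μ(Iᵏ)` in terms of the tail of the `h`-vector. -/
theorem mu_pow_succ (hI : IsGradedIdeal I) (k : ℕ) :
    (mu (I ^ (k + 1)) : ℤ) =
      ((analyticSpread I + k - 1).choose k : ℤ) * mu I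
        - k * ((analyticSpread I + k - 1).choose (k + 1) : ℤ)
        + PowerSeries.coeff (k + 1)
          ((invOneSubPow ℤ (analyticSpread I) : PowerSeries ℤ) * hTail I) := by
  rw [← coeff_invOneSubPow_mul_linear, ← map_add, ← mul_add, ← mk_hCoeff hI,
    ← hilbertSeries_eq_invOneSubPow_mul, coeff_hilbertSeries I hI]

theorem mu_pow_eq (hI : IsGradedIdeal I) {k : ℕ} (hk : 1 ≤ k) :
    (mu (I ^ k) : ℤ) =
      ((analyticSpread I + k - 2).choose (k - 1) : ℤ) * (mu I : ℤ)
        - ((k : ℤ) - 1) * ((analyticSpread I + k - 2).choose k : ℤ)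
        + PowerSeries.coeff k
          ((invOneSubPow ℤ (analyticSpread I) : PowerSeries ℤ) * hTail I) := by
  obtain ⟨k, rfl⟩ := Nat.exists_eq_succ_of_ne_zero (Nat.one_le_iff_ne_zero.mp hk)
  have h : analyticSpread I + (k + 1) - 2 = analyticSpread I + k - 1 := by omega
  rw [Nat.succ_eq_add_one, mu_pow_succ hI, h, Nat.add_sub_cancel]
  push_cast
  ring

/-- At k = 2 the formula is l μ(I) - binom(l, 2), and the defect is h₂ because R starts in degree
two. -/
theorem hCoeff_two (hI : IsGradedIdeal I) : hCoeff I 2 = Delta I := by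
  have h := mu_pow_eq hI one_le_two
  rw [PowerSeries.coeff_mul, Finset.Nat.sum_antidiagonal_eq_sum_range_succ_mk] at h
  norm_num [Finset.sum_range_succ, hTail, PowerSeries.coeff_mk, coeff_zero_invOneSubPow,
    -coeff_zero_eq_constantCoeff] at h
  rw [Delta]
  linarith

theorem hTail_eq_zero_iff : hTail I = 0 ↔ ∀ i, 2 ≤ i → hCoeff I i = 0 := by
  rw [PowerSeries.ext_iff]
  refine forall_congr' fun i => ?_
  rw [hTail, PowerSeries.coeff_mk, map_zero]
  by_cases hi : i < 2
  · simp [hi]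
  · simp [hi, not_lt.mp hi]

theorem coeff_hTail_nonneg (h : ∀ i, 2 ≤ i → 0 ≤ hCoeff I i) (i : ℕ) :
    0 ≤ PowerSeries.coeff i (hTail I) := by
  rw [hTail, PowerSeries.coeff_mk]
  split_ifs with hi
  · exact le_rfl
  · exact h i (not_lt.mp hi)

theorem coeff_invOneSubPow_mul_hTail_nonneg (h : ∀ i, 2 ≤ i → 0 ≤ hCoeff I i) (l k : ℕ) :
    0 ≤ PowerSeries.coeff k ((invOneSubPow ℤ l : PowerSeries ℤ) * hTail I) := by
  rw [PowerSeries.coeff_mul]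
  exact Finset.sum_nonneg fun p _ =>
    mul_nonneg (coeff_invOneSubPow_nonneg _ _) (coeff_hTail_nonneg h _)

/-- The formula for all k says R/(1 - t)^l = 0, equivalently R = 0. Degree zero imposes nothing. -/
theorem forall_mu_pow_eq_iff (hI : IsGradedIdeal I) :
    (∀ k : ℕ, 1 ≤ k →
      (mu (I ^ k) : ℤ) =
        ((analyticSpread I + k - 2).choose (k - 1) : ℤ) * (mu I : ℤ)
          - ((k : ℤ) - 1) * ((analyticSpread I + k - 2).choose k : ℤ)) ↔
      ∀ i : ℕ, 2 ≤ i → hCoeff I i = 0 := by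
  rw [← hTail_eq_zero_iff,
    ← (invOneSubPow ℤ (analyticSpread I)).isUnit.mul_right_eq_zero (b := hTail I),
    PowerSeries.ext_iff]
  refine forall_congr' fun k => ?_
  rcases Nat.eq_zero_or_pos k with rfl | hk
  · simp [hTail]
  · rw [mu_pow_eq hI hk]
    simp [Nat.one_le_iff_ne_zero, hk.ne']

theorem hCoeff_eq_zero_of_isCohenMacaulay (h : IsCohenMacaulay (FiberCone I))
    (h2 : hCoeff I 2 = 0) : ∀ i, 2 ≤ i → hCoeff I i = 0 :=
  Nat.le_induction h2 fun i _ hi => (hCoeff_nonneg_of_isCohenMacaulay h i).2 hi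

/-- For an ideal of analytic spread zero, the numerical formula says that `Iᵏ` vanishes. -/
theorem eq_bot_of_mu_pow_eq (hl : analyticSpread I = 0) {k : ℕ} (hk : 2 ≤ k)
    (h : (mu (I ^ k) : ℤ) =
      ((analyticSpread I + k - 2).choose (k - 1) : ℤ) * (mu I : ℤ)
        - ((k : ℤ) - 1) * ((analyticSpread I + k - 2).choose k : ℤ)) : I = ⊥ := by
  rw [hl, Nat.choose_eq_zero_of_lt (by omega : 0 + k - 2 < k - 1),
    Nat.choose_eq_zero_of_lt (by omega : 0 + k - 2 < k)] at h
  have h0 : mu (I ^ k) = 0 := by simpa using h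
  have hbot : I ^ k = ⊥ :=
    (Submodule.spanFinrank_eq_zero_iff_eq_bot (IsNoetherian.noetherian (I ^ k))).1 h0
  exact eq_zero_of_pow_eq_zero hbot

theorem Delta_eq_zero_of_mu_pow_eq (hI : IsGradedIdeal I) (hF : IsCohenMacaulay (FiberCone I))
    {k : ℕ} (hk : 2 ≤ k)
    (h : (mu (I ^ k) : ℤ) =
      ((analyticSpread I + k - 2).choose (k - 1) : ℤ) * (mu I : ℤ)
        - ((k : ℤ) - 1) * ((analyticSpread I + k - 2).choose k : ℤ)) : Delta I = 0 := by
  -- For l = 0 the defect at k is just hₖ and does not see h₂; there the formula itself forces I =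
  -- 0.
  rcases Nat.eq_zero_or_pos (analyticSpread I) with hl | hl
  · have hI0 := eq_bot_of_mu_pow_eq hl hk h
    have hsq : I ^ 2 = ⊥ := by rw [hI0, ← Ideal.zero_eq_bot, zero_pow two_ne_zero]
    have hmu : mu (⊥ : Ideal (MvPolynomial (Fin n) K)) = 0 := Submodule.spanFinrank_bot
    rw [Delta, hl, hsq, hmu]
    simp
  · rw [← hCoeff_two hI]
    have h0 : PowerSeries.coeff k
        ((invOneSubPow ℤ (analyticSpread I) : PowerSeries ℤ) * hTail I) = 0 := by
      have := mu_pow_eq hI (one_le_two.trans hk)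
      linarith
    have hnonneg := coeff_hTail_nonneg fun i _ => (hCoeff_nonneg_of_isCohenMacaulay hF i).1
    rw [PowerSeries.coeff_mul, Finset.sum_eq_zero_iff_of_nonneg fun p _ =>
      mul_nonneg (coeff_invOneSubPow_nonneg _ _) (hnonneg _)] at h0
    -- All terms of the vanishing defect are nonnegative, and h₂ enters with the coefficient of
    -- t^(k-2), which is positive because l > 0.
    have h2 := h0 (k - 2, 2) (by simp [hk])
    simpa [(coeff_invOneSubPow_pos hl _).ne', hTail] using h2

end HVector

end FiberConeHVector

open FiberConeHVector in
theorem proposition1p6 {K : Type*} [Field K] {n : ℕ}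
    (I : Ideal (MvPolynomial (Fin n) K)) (hI : IsGradedIdeal I)
    (l : ℕ) (hl : l = analyticSpread I) :
    ((∀ i : ℕ, 2 ≤ i → 0 ≤ hCoeff I i) →
      ∀ k : ℕ, 1 ≤ k →
        (mu (I ^ k) : ℤ) ≥ ((l + k - 2).choose (k - 1) : ℤ) * (mu I : ℤ)
          - ((k : ℤ) - 1) * ((l + k - 2).choose k : ℤ)) ∧
    ((∀ k : ℕ, 1 ≤ k →
        (mu (I ^ k) : ℤ) = ((l + k - 2).choose (k - 1) : ℤ) * (mu I : ℤ)
          - ((k : ℤ) - 1) * ((l + k - 2).choose k : ℤ)) ↔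
      ∀ i : ℕ, 2 ≤ i → hCoeff I i = 0) ∧
    (IsCohenMacaulay (FiberCone I) →
      List.TFAE [
        Delta I = 0,
        ∀ k : ℕ, 1 ≤ k →
          (mu (I ^ k) : ℤ) = ((l + k - 2).choose (k - 1) : ℤ) * (mu I : ℤ)
            - ((k : ℤ) - 1) * ((l + k - 2).choose k : ℤ),
        ∃ k : ℕ, 2 ≤ k ∧
          (mu (I ^ k) : ℤ) = ((l + k - 2).choose (k - 1) : ℤ) * (mu I : ℤ)
            - ((k : ℤ) - 1) * ((l + k - 2).choose k : ℤ)]) := by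
  subst hl
  refine ⟨fun h k hk => ?_, forall_mu_pow_eq_iff hI, fun hF => ?_⟩
  · have := coeff_invOneSubPow_mul_hTail_nonneg h (analyticSpread I) k
    rw [mu_pow_eq hI hk]
    linarith
  · tfae_have 1 → 2 := fun h => (forall_mu_pow_eq_iff hI).2
      (hCoeff_eq_zero_of_isCohenMacaulay hF ((hCoeff_two hI).trans h))
    tfae_have 2 → 3 := fun h => ⟨2, le_rfl, h 2 one_le_two⟩
    tfae_have 3 → 1 := fun ⟨k, hk, h⟩ => Delta_eq_zero_of_mu_pow_eq hI hF hk h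
    tfae_finish
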